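/- Let $\mathbf F$ be a finite field with $q$ elements, and let $U_n$ be the group of upper triangular $n\times n$ matrices over $\mathbf F$ with all diagonal entries equal to $1$. For a finite group $G$ let $N_k(G)$ be the number of complex irreducible characters $\chi$ of $G$ with $\chi(1)=k$. For $m\ge 3$ let $Q_{m,1,3}$ be the subgroup of $U_m$ consisting of the matrices whose $(2,3)$-entry is $0$. Then: (a) For all $n\ge 6$, $$N_{q^2}(U_n)=qN_{q^2}(U_{n-1})+qN_q(U_{n-1})-qN_q(U_{n-2})+(q-1)^2N_1(Q_{n-2,1,3})$$ $$\phantom{N_{q^2}(U_n)}=qN_{q^2}(U_{n-1})+q^{n-4}(q-1)\left[q^3+(n-5)q^2-(n-6)q-1\right].$$ (b) For all $n\ge 5$, $$N_{q^2}(U_n)=q^{n-4}(q-1)\left\{(n-5)q^3+\left(\tfrac{(n-5)(n-4)}{2}+2\right)q^2+\left[1-\tfrac{(n-6)(n-5)}{2}\right]q-n+4\right\},$$ and, for each such $n$, the right-hand side is a polynomial in $q$ with integer coefficients (depending only on $n$). (c) For all $n\ge 3$, $N_q(U_n)=q^{n-3}(q-1)\left((n-3)q+1\right)$. -/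

import Mathlib

open Polynomial

/-- `Irr(G)`: the set of complex irreducible characters of `G`, i.e. the characters (traces) of the
finite-dimensional irreducible complex representations of `G`. -/
def Irr (G : Type*) [Group G] : Set (G → ℂ) :=
  {χ | ∃ (V : Type) (_ : AddCommGroup V) (_ : Module ℂ V) (_ : FiniteDimensional ℂ V)
    (ρ : Representation ℂ G V), ρ.IsIrreducible ∧ χ = ρ.character}

/-- `N_k(G)`: the number of irreducible characters `χ` of `G` of degree `χ(1) = k`. -/
noncomputable def numIrr (k : ℕ) (G : Type*) [Group G] : ℕ :=
  Set.ncard {χ : G → ℂ | χ ∈ Irr G ∧ χ 1 = (k : ℂ)}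

/-- The inverse of an invertible upper triangular matrix with unit diagonal has the same shape. -/
theorem unitri_inv {F : Type*} [Field F] {n : ℕ} (A : GL (Fin n) F)
    (h0 : ∀ i j : Fin n, j < i → A.val i j = 0) (h1 : ∀ i : Fin n, A.val i i = 1) :
    (∀ i j : Fin n, j < i → (A⁻¹).val i j = 0) ∧ ∀ i : Fin n, (A⁻¹).val i i = 1 := by
  have hA : A.val.BlockTriangular id := fun i j hij => h0 i j hij
  have hB : (A⁻¹).val.BlockTriangular id := by
    letI : Invertible A.val := A.invertible
    rw [Matrix.coe_units_inv]
    exact Matrix.blockTriangular_inv_of_blockTriangular hA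
  refine ⟨fun i j hij => hB hij, fun i => ?_⟩
  have h : ((A⁻¹).val * A.val) i i = 1 := by
    rw [← Units.val_mul, inv_mul_cancel]; simp
  rw [Matrix.mul_apply, Finset.sum_eq_single i, h1, mul_one] at h
  · exact h
  · intro k _ hk
    rcases lt_or_gt_of_ne hk with hk | hk
    · rw [hB hk, zero_mul]
    · rw [h0 k i hk, mul_zero]
  · simp

/-- `U_n` over `F`: the group of upper triangular `n × n` matrices over `F` with all diagonal
entries equal to `1`. -/
def unitriangular (F : Type*) [Field F] (n : ℕ) : Subgroup (GL (Fin n) F) where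
  carrier := {A | (∀ i j : Fin n, j < i → A.val i j = 0) ∧ ∀ i : Fin n, A.val i i = 1}
  one_mem' := ⟨fun i j h => by simp [Matrix.one_apply, h.ne'], fun i => by simp⟩
  mul_mem' := by
    rintro A B ⟨hA0, hA1⟩ ⟨hB0, hB1⟩
    refine ⟨fun i j hij => ?_, fun i => ?_⟩
    · rw [Units.val_mul, Matrix.mul_apply]
      refine Finset.sum_eq_zero fun k _ => ?_
      rcases lt_or_ge k i with hk | hk
      · rw [hA0 i k hk, zero_mul]
      · rw [hB0 k j (hij.trans_le hk), mul_zero]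
    · rw [Units.val_mul, Matrix.mul_apply, Finset.sum_eq_single i, hA1, hB1, mul_one]
      · intro k _ hk
        rcases lt_or_gt_of_ne hk with hk | hk
        · rw [hA0 i k hk, zero_mul]
        · rw [hB0 k i hk, mul_zero]
      · simp
  inv_mem' := fun {A} h => unitri_inv A h.1 h.2

/-- `Q_{n,i₁,i₂}` (with `1`-based indices `i₁ < i₂`): the subgroup of those `A ∈ U_n` such that
`a_{y,i₁} = 0` for `y = 1, …, i₁ - 1` and `a_{x,i₂} = 0` for `x = 1, …, i₂ - 1`, `x ≠ i₁`.
A row or column `x : Fin n` has the `1`-based index `x + 1`. -/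
def subgroupQ (F : Type*) [Field F] (n i₁ i₂ : ℕ) : Subgroup (GL (Fin n) F) where
  carrier := {A | A ∈ unitriangular F n ∧
    (∀ y c : Fin n, c.val + 1 = i₁ → y < c → A.val y c = 0) ∧
    (∀ x c : Fin n, c.val + 1 = i₂ → x < c → x.val + 1 ≠ i₁ → A.val x c = 0)}
  one_mem' := ⟨one_mem _, fun y c _ h => by simp [Matrix.one_apply, h.ne],
    fun x c _ h _ => by simp [Matrix.one_apply, h.ne]⟩
  mul_mem' := by
    rintro A B ⟨hA, hA1, hA2⟩ ⟨hB, hB1, hB2⟩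
    refine ⟨mul_mem hA hB, fun y c hc hy => ?_, fun x c hc hx hxi => ?_⟩
    · rw [Units.val_mul, Matrix.mul_apply]
      refine Finset.sum_eq_zero fun k _ => ?_
      rcases lt_trichotomy k c with hk | hk | hk
      · rw [hB1 k c hc hk, mul_zero]
      · rw [hk, hA1 y c hc hy, zero_mul]
      · rw [hB.1 k c hk, mul_zero]
    · rw [Units.val_mul, Matrix.mul_apply]
      refine Finset.sum_eq_zero fun k _ => ?_
      rcases lt_trichotomy k c with hk | hk | hk
      · by_cases hki : k.val + 1 = i₁
        · rcases lt_trichotomy x k with hxk | hxk | hxk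
          · rw [hA1 x k hki hxk, zero_mul]
          · exact absurd (hxk ▸ hki) hxi
          · rw [hA.1 x k hxk, zero_mul]
        · rw [hB2 k c hc hk hki, mul_zero]
      · rw [hk, hA2 x c hc hx hxi, zero_mul]
      · rw [hB.1 k c hk, mul_zero]
  inv_mem' := by
    rintro A ⟨hA, hA1, hA2⟩
    have hB : A⁻¹ ∈ unitriangular F n := inv_mem hA
    have key : ∀ y c : Fin n, y < c → ((A⁻¹).val * A.val) y c = 0 := fun y c h => by
      rw [← Units.val_mul, inv_mul_cancel]; simp [Matrix.one_apply, h.ne]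
    have inv1 : ∀ y c : Fin n, c.val + 1 = i₁ → y < c → (A⁻¹).val y c = 0 := by
      intro y c hc hy
      have h := key y c hy
      rw [Matrix.mul_apply, Finset.sum_eq_single c, hA.2, mul_one] at h
      · exact h
      · intro k _ hk
        rcases lt_or_gt_of_ne hk with hk | hk
        · rw [hA1 k c hc hk, mul_zero]
        · rw [hA.1 k c hk, mul_zero]
      · simp
    refine ⟨hB, inv1, fun x c hc hx hxi => ?_⟩
    have h := key x c hx
    rw [Matrix.mul_apply, Finset.sum_eq_single c, hA.2, mul_one] at h
    · exact h
    · intro k _ hk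
      rcases lt_or_gt_of_ne hk with hk | hk
      · by_cases hki : k.val + 1 = i₁
        · rcases lt_trichotomy x k with hxk | hxk | hxk
          · rw [inv1 x k hki hxk, zero_mul]
          · exact absurd (hxk ▸ hki) hxi
          · rw [hB.1 x k hxk, zero_mul]
        · rw [hA2 k c hc hk hki, mul_zero]
      · rw [hA.1 k c hk, mul_zero]
    · simp

/-!
The proof counts irreducible characters with the little group method of Wigner and Mackey.

Let `G` be the semidirect product of a complement `H` and an abelian normal subgroup `A`. The
weights of an irreducible representation of `G`, that is, the characters of `A` occurring in it,
form one `H`-orbit, and the weight space of a weight `x` is an irreducible representation of the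
stabilizer of `x`. On the level of characters, passing to this representation is a Fourier
coefficient (`SplitExtension.component`), from which the character of `G` can be recovered
(`SplitExtension.eq_of_component_eq`); every irreducible representation of the stabilizer arises,
by coinduction (`SplitExtension.exists_mem_Irr_component_eq`). Degrees are multiplied by the length
of the orbit, so that `N_k(G)` is the sum of `N_{k/|O|}` of the stabilizers over the orbits `O`
whose length divides `k` (`SplitExtension.numIrr_eq_sum`). In particular `N_1(G)` is `N_1(H)` times the
number of `H`-fixed characters of `A` (`SplitExtension.numIrr_one_eq_mul`).

This is applied to the first row of matrix groups. All groups that occur are of the form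
`patternSubgroup F n s i`, the matrices in `U_n` whose column `i` vanishes in the rows
`s, …, i - 1`, numbered from `0`: `U_n` itself, the groups with `s = 0`, in which column `i` is
trivial, and `Q_{n,1,3} = patternSubgroup F n 1 2`. In size `m + 1` such a group is the semidirect
product of `patternSubgroup F m (s - 1) (i - 1)`, its lower right block, and the group of its first rows
(`rowExtension`), whose characters are column vectors. For `U_{m+1}` and
`patternSubgroup F (m + 1) 0 1` the lower right block runs through all of `U_m`, and the orbits of
nonzero column vectors are classified by the position and the value of their last nonzero entry; an
orbit has length `q ^ l`, where `l` counts the free positions before the last nonzero one, and the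
stabilizer is again a pattern subgroup (`numIrr_patternSubgroup_succ`). For the degrees `1`, `q`
and `q ^ 2` only `l ≤ 2` matters. This gives a closed system of recursions for these character
numbers, in which the values of `N_1` at the patterns with `i = 2` are supplied by counting fixed
vectors (`numIrr_one_patternSubgroup_two`).
-/

/-! ### Irreducible characters of a finite group -/

/-- Irreducibility of a representation, in terms of invariant submodules. -/
theorem isIrreducible_iff_forall_submodule {k G V : Type*} [Field k] [Group G] [AddCommGroup V]
    [Module k V] (ρ : Representation k G V) :
    ρ.IsIrreducible ↔ Nontrivial V ∧
      ∀ W : Submodule k V, (∀ g, ∀ v ∈ W, ρ g v ∈ W) → W = ⊥ ∨ W = ⊤ := by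
  constructor
  · intro h
    refine ⟨?_, fun W hW => ?_⟩
    · by_contra hV
      rw [not_nontrivial_iff_subsingleton] at hV
      obtain ⟨a, b, hab⟩ := h.exists_pair_ne
      exact hab (Subrepresentation.toSubmodule_injective (Subsingleton.elim _ _))
    · rcases h.eq_bot_or_eq_top ⟨W, fun g v hv => hW g v hv⟩ with h | h
      · exact Or.inl (congrArg Subrepresentation.toSubmodule h)
      · exact Or.inr (congrArg Subrepresentation.toSubmodule h)
  · rintro ⟨hV, h⟩
    have : Nontrivial (Subrepresentation ρ) := by
      refine ⟨⊥, ⊤, fun he => ?_⟩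
      have : (⊥ : Submodule k V) = ⊤ := congrArg Subrepresentation.toSubmodule he
      exact bot_ne_top this
    exact ⟨fun W => (h W.toSubmodule fun g v hv => W.apply_mem_toSubmodule g hv).imp
      (fun e => Subrepresentation.toSubmodule_injective e)
      (fun e => Subrepresentation.toSubmodule_injective e)⟩

/-- The character of an irreducible representation on a space in any universe belongs to
`Irr G`. -/
theorem character_mem_Irr {G V : Type*} [Group G] [AddCommGroup V] [Module ℂ V]
    [FiniteDimensional ℂ V] {ρ : Representation ℂ G V} (h : ρ.IsIrreducible) :
    ρ.character ∈ Irr G := by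
  let e : V ≃ₗ[ℂ] (Fin (Module.finrank ℂ V) → ℂ) := (Module.finBasis ℂ V).equivFun
  let σ : Representation ℂ G (Fin (Module.finrank ℂ V) → ℂ) :=
    { toFun := fun g => e.conj (ρ g)
      map_one' := by ext; simp
      map_mul' := fun a b => by ext; simp [LinearEquiv.conj_apply] }
  have hσ : ∀ g v, σ g (e v) = e (ρ g v) := fun g v => by
    simp [σ, LinearEquiv.conj_apply]
  rw [isIrreducible_iff_forall_submodule] at h
  obtain ⟨hV, h⟩ := h
  refine ⟨_, inferInstance, inferInstance, inferInstance, σ, ?_, ?_⟩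
  · rw [isIrreducible_iff_forall_submodule]
    refine ⟨e.symm.toEquiv.nontrivial, fun W hW => ?_⟩
    have := h (W.comap e.toLinearMap) fun g v hv => by
      simp only [Submodule.mem_comap, LinearEquiv.coe_coe] at hv ⊢
      rw [← hσ]; exact hW g _ hv
    refine this.imp (fun h0 => ?_) (fun h0 => ?_)
    · rw [eq_bot_iff]
      intro w hw
      have : e.symm w ∈ W.comap e.toLinearMap := by simpa using hw
      rw [h0, Submodule.mem_bot] at this
      simpa using this
    · rw [eq_top_iff]
      intro w _
      have : e.symm w ∈ W.comap e.toLinearMap := h0 ▸ Submodule.mem_top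
      simpa using this
  · ext g
    exact (LinearMap.trace_conj' (ρ g) e).symm

/-- Orthogonality of irreducible characters. Non-isomorphic representations have
distinct characters, since the product of a character with itself does not vanish. -/
theorem sum_Irr_mul_eq {G : Type*} [Group G] [Fintype G] {χ ψ : G → ℂ} (hχ : χ ∈ Irr G)
    (hψ : ψ ∈ Irr G) :
    ∑ g : G, χ g * ψ g⁻¹ = if χ = ψ then (Nat.card G : ℂ) else 0 := by
  classical
  obtain ⟨V, _, _, _, ρ, hρ, rfl⟩ := hχ
  obtain ⟨W, _, _, _, σ, hσ, rfl⟩ := hψ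
  have hG : (Nat.card G : ℂ) ≠ 0 := by simp [Nat.card_eq_fintype_card]
  let _ : Invertible (Nat.card G : ℂ) := invertibleOfNonzero hG
  have key := Representation.char_orthonormal ρ σ
  by_cases h : Nonempty (σ.Equiv ρ)
  · rw [if_pos h] at key
    rw [if_pos (Representation.char_iso h.some).symm]
    field_simp at key
    exact key
  · rw [if_neg h] at key
    have h0 : ∑ g : G, ρ.character g * σ.character g⁻¹ = 0 := by
      simpa [hG] using key
    rw [if_neg, h0]
    intro he
    have h1 := Representation.char_orthonormal ρ ρ
    rw [if_pos ⟨Representation.Equiv.refl ρ⟩] at h1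
    rw [← he] at h0
    rw [h0] at h1
    simp at h1

/-- The irreducible characters are linearly independent functions on `G`, so there are finitely
many of them. -/
theorem Irr_finite (G : Type*) [Group G] [Finite G] : (Irr G).Finite := by
  classical
  have := Fintype.ofFinite G
  have hG : (Nat.card G : ℂ) ≠ 0 := by simp [Nat.card_eq_fintype_card]
  have hli : LinearIndependent ℂ (fun χ : Irr G => (χ : G → ℂ)) := by
    rw [linearIndependent_iff']
    intro s c hc χ hχ
    have h1 : ∑ g : G, (∑ ψ ∈ s, c ψ • (ψ : G → ℂ)) g * (χ : G → ℂ) g⁻¹ = 0 := by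
      rw [hc]; simp
    simp only [Finset.sum_apply, Pi.smul_apply, smul_eq_mul, Finset.sum_mul] at h1
    rw [Finset.sum_comm] at h1
    simp only [mul_assoc, ← Finset.mul_sum, sum_Irr_mul_eq (Subtype.prop _) (Subtype.prop _)] at h1
    rw [Finset.sum_eq_single χ] at h1
    · simpa [hG] using h1
    · intro ψ _ hne
      rw [if_neg (fun h => hne (Subtype.ext h)), mul_zero]
    · exact fun h => absurd hχ h
  have := hli.finite
  exact Set.toFinite _

/-- Every nonzero finite-dimensional representation contains an irreducible one. -/
theorem exists_irreducible_subrepresentation {G V : Type*} [Group G] [AddCommGroup V]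
    [Module ℂ V] [FiniteDimensional ℂ V] [Nontrivial V] (ρ : Representation ℂ G V) :
    ∃ W : Subrepresentation ρ, W.toRepresentation.IsIrreducible := by
  let S : Set (Submodule ℂ V) := {W | W ≠ ⊥ ∧ ∀ g, ∀ v ∈ W, ρ g v ∈ W}
  obtain ⟨W, ⟨hW0, hWi⟩, hmin⟩ := (wellFounded_lt (α := Submodule ℂ V)).has_min S
    ⟨⊤, top_ne_bot, fun _ _ _ => Submodule.mem_top⟩
  refine ⟨⟨W, fun g v hv => hWi g v hv⟩, ?_⟩
  rw [isIrreducible_iff_forall_submodule]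
  refine ⟨Submodule.nontrivial_iff_ne_bot.2 hW0, fun U hU => ?_⟩
  by_cases hb : U = ⊥
  · exact Or.inl hb
  · right
    have hmem : U.map W.subtype ∈ S := by
      refine ⟨fun h => hb ?_, ?_⟩
      · exact Submodule.map_injective_of_injective W.injective_subtype
          (h.trans (Submodule.map_bot _).symm)
      · rintro g _ ⟨u, hu, rfl⟩
        exact ⟨_, hU g u hu, rfl⟩
    have hle : U.map W.subtype ≤ W := Submodule.map_subtype_le W U
    have he : U.map W.subtype = W := hle.eq_or_lt.resolve_right (hmin _ hmem)
    apply Submodule.map_injective_of_injective W.injective_subtype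
    rw [he]; simp

theorem comp_mem_Irr {G H : Type*} [Group G] [Group H] (e : G ≃* H) (χ : H → ℂ) (hχ : χ ∈ Irr H) :
    χ ∘ e ∈ Irr G := by
  obtain ⟨V, _, _, _, ρ, hρ, rfl⟩ := hχ
  refine ⟨V, inferInstance, inferInstance, inferInstance, ρ.comp e.toMonoidHom, ?_, rfl⟩
  rw [isIrreducible_iff_forall_submodule] at hρ ⊢
  refine ⟨hρ.1, fun W hW => hρ.2 W fun h v hv => ?_⟩
  simpa using hW (e.symm h) v hv

theorem numIrr_congr {G H : Type*} [Group G] [Group H] (e : G ≃* H) (k : ℕ) :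
    numIrr k G = numIrr k H := by
  refine Set.ncard_congr (fun χ _ => χ ∘ e.symm) ?_ ?_ ?_
  · rintro χ ⟨h1, h2⟩
    exact ⟨comp_mem_Irr e.symm χ h1, by simpa using h2⟩
  · intro χ ψ _ _ h
    ext g
    simpa using congrFun h (e g)
  · rintro χ ⟨h1, h2⟩
    exact ⟨χ ∘ e, ⟨comp_mem_Irr e χ h1, by simpa using h2⟩, by ext; simp⟩

theorem numIrr_of_subsingleton (G : Type*) [Group G] [Subsingleton G] (k : ℕ) :
    numIrr k G = if k = 1 then 1 else 0 := by
  have hI : Irr G = {fun _ => 1} := by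
    have h1 : ∀ χ ∈ Irr G, χ = fun _ => 1 := by
      rintro _ ⟨V, _, _, _, ρ, hρ, rfl⟩
      have hid : ∀ g v, ρ g v = v := fun g v => by rw [Subsingleton.elim g 1]; simp
      rw [isIrreducible_iff_forall_submodule] at hρ
      obtain ⟨hV, h⟩ := hρ
      obtain ⟨v, hv⟩ := exists_ne (0 : V)
      have hs := (h (Submodule.span ℂ {v}) fun g w hw => by rwa [hid]).resolve_left
        (by simpa using hv)
      have hd : Module.finrank ℂ V = 1 := by
        rw [← finrank_top ℂ V, ← hs, finrank_span_singleton hv]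
      ext g
      rw [Subsingleton.elim g 1, Representation.char_one, hd, Nat.cast_one]
    refine Set.Subset.antisymm (fun χ hχ => h1 χ hχ) ?_
    rintro _ rfl
    obtain ⟨W, hW⟩ := exists_irreducible_subrepresentation (Representation.trivial ℂ G ℂ)
    have := character_mem_Irr hW
    rwa [h1 _ this] at this
  rw [numIrr, hI]
  split_ifs with hk
  · rw [Set.ncard_eq_one]
    exact ⟨fun _ => 1, by ext χ; simp +contextual [hk]⟩
  · convert Set.ncard_empty (G → ℂ) using 2
    ext χ
    simp only [Set.mem_singleton_iff, Set.mem_ofPred_eq, Set.mem_empty_iff_false, iff_false,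
      not_and]
    rintro rfl h
    exact hk (by simpa using h.symm)

/-! ### The little group method for a split abelian normal subgroup -/

/-- A decomposition of `G` as a semidirect product of a complement `β(H)` and an abelian normal
subgroup `α(A)`. Here `act h a` is the conjugate of `a` by `h⁻¹`, so that `act` is a right action
of `H` on `A`. The set `X` with a left action of `H` parametrizes the characters of `A` through
`char`, equivariantly for the induced left action of `H` on the characters. -/
structure SplitExtension (G H A X : Type*) [Group G] [Group H] [AddCommGroup A]
    [MulAction H X] where
  /-- The inclusion of the abelian normal subgroup, written additively. -/
  α : A → G
  /-- The inclusion of the complement. -/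
  β : H →* G
  /-- The conjugation action of the complement, as a right action. -/
  act : H → A →+ A
  /-- The parametrization of the characters of `A`. -/
  char : X → AddChar A ℂ
  α_add : ∀ a b, α (a + b) = α a * α b
  comm : ∀ a h, α a * β h = β h * α (act h a)
  bijective_mul : Function.Bijective fun x : H × A => β x.1 * α x.2
  bijective_char : Function.Bijective char
  char_smul : ∀ h x a, char (h • x) a = char x (act h a)

namespace SplitExtension

open MulAction

variable {G H A X : Type*} [Group G] [Group H] [AddCommGroup A] [MulAction H X]
  (S : SplitExtension G H A X)

theorem α_zero : S.α 0 = 1 := by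
  have := S.α_add 0 0
  rwa [add_zero, left_eq_mul] at this

theorem α_neg (a : A) : S.α (-a) = (S.α a)⁻¹ := by
  rw [eq_inv_iff_mul_eq_one, ← S.α_add, neg_add_cancel, S.α_zero]

theorem exists_eq (g : G) : ∃ h a, g = S.β h * S.α a := by
  obtain ⟨⟨h, a⟩, hg⟩ := S.bijective_mul.2 g
  exact ⟨h, a, hg.symm⟩

theorem exists_eq' (g : G) : ∃ a h, g = S.α a * S.β h := by
  obtain ⟨h, a, hg⟩ := S.exists_eq g⁻¹
  refine ⟨-a, h⁻¹, ?_⟩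
  rw [← inv_inv g, hg, mul_inv_rev, S.α_neg, map_inv]

section Weights

variable {V : Type*} [AddCommGroup V] [Module ℂ V] (ρ : Representation ℂ G V)

/-- The subspace of a representation of `G` on which `A` acts by the character `x`. -/
def weightSpace (x : X) : Submodule ℂ V where
  carrier := {v | ∀ a, ρ (S.α a) v = S.char x a • v}
  add_mem' hv hw a := by rw [map_add, hv a, hw a, smul_add]
  zero_mem' a := by simp
  smul_mem' c v hv a := by rw [map_smul, hv a, smul_comm]

variable {ρ}

theorem smul_mem_weightSpace {x : X} {v : V} (hv : v ∈ S.weightSpace ρ x) (h : H) :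
    ρ (S.β h) v ∈ S.weightSpace ρ (h • x) := fun a => by
  rw [← Module.End.mul_apply, ← map_mul, S.comm, map_mul, Module.End.mul_apply, hv, map_smul,
    S.char_smul]

/-- In an irreducible representation the translates of a nonzero subspace of a weight space span
everything. -/
theorem iSup_map_eq_top (hρ : ρ.IsIrreducible) {x : X} {W : Submodule ℂ V}
    (hW : W ≤ S.weightSpace ρ x) (h0 : W ≠ ⊥) : ⨆ h, W.map (ρ (S.β h)) = ⊤ := by
  refine ((isIrreducible_iff_forall_submodule ρ).1 hρ |>.2 _ fun g v hv => ?_).resolve_left ?_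
  · obtain ⟨a, k, rfl⟩ := S.exists_eq' g
    refine (Submodule.map_le_iff_le_comap.1 ?_ : _ ≤ (⨆ h, W.map (ρ (S.β h))).comap _) hv
    rw [Submodule.map_iSup]
    refine iSup_le fun h => ?_
    rintro _ ⟨_, ⟨w, hw, rfl⟩, rfl⟩
    have : ρ (S.α a * S.β k) (ρ (S.β h) w) = S.char ((k * h) • x) a • ρ (S.β (k * h)) w := by
      rw [← S.smul_mem_weightSpace (hW hw) (k * h), map_mul, map_mul, map_mul]
      rfl
    rw [this]
    exact Submodule.smul_mem _ _ (le_iSup (fun h => W.map (ρ (S.β h))) (k * h) ⟨w, hw, rfl⟩)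
  · intro hb
    refine h0 (eq_bot_iff.2 fun w hw => ?_)
    rw [← hb]
    exact le_iSup (fun h => W.map (ρ (S.β h))) 1 ⟨w, hw, by simp⟩

variable (ρ)

/-- The representation of the stabilizer of `x` on the weight space of `x`. -/
def weightRep (x : X) : Representation ℂ (stabilizer H x) (S.weightSpace ρ x) where
  toFun k := (ρ (S.β k)).restrict fun v hv => by
    have := S.smul_mem_weightSpace hv (k : H)
    rwa [k.2] at this
  map_one' := by ext; simp
  map_mul' a b := by ext; simp

variable [Fintype A]

/-- The projection of a representation onto the weight space of `x`. -/
noncomputable def proj (x : X) : V →ₗ[ℂ] V :=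
  (Fintype.card A : ℂ)⁻¹ • ∑ a, S.char x (-a) • ρ (S.α a)

theorem proj_apply (x : X) (v : V) :
    S.proj ρ x v = (Fintype.card A : ℂ)⁻¹ • ∑ a, S.char x (-a) • ρ (S.α a) v := by
  simp [proj, LinearMap.sum_apply]

theorem card_ne_zero' : (Fintype.card A : ℂ) ≠ 0 := by simp

theorem proj_mem (x : X) (v : V) : S.proj ρ x v ∈ S.weightSpace ρ x := fun b => by
  simp only [proj_apply, map_smul, map_sum]
  rw [smul_comm (S.char x b)]
  congr 1
  rw [Finset.smul_sum]
  conv_rhs => rw [← Equiv.sum_comp (Equiv.addLeft b)]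
  refine Finset.sum_congr rfl fun a _ => ?_
  rw [← Module.End.mul_apply, ← map_mul, ← S.α_add, smul_smul, Equiv.coe_addLeft, neg_add,
    AddChar.map_add_eq_mul, ← mul_assoc, ← AddChar.map_add_eq_mul, add_neg_cancel,
    AddChar.map_zero_eq_one, one_mul]

variable {ρ}

open Classical in
theorem proj_of_mem {x : X} {v : V} (hv : v ∈ S.weightSpace ρ x) (y : X) :
    S.proj ρ y v = if y = x then v else 0 := by
  have h1 : ∑ a, S.char y (-a) * S.char x a = if y = x then (Fintype.card A : ℂ) else 0 := by
    have := AddChar.sum_eq_ite (S.char x - S.char y)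
    simp only [AddChar.sub_apply, sub_eq_zero, S.bijective_char.1.eq_iff] at this
    simp only [mul_comm (S.char y _), this, eq_comm]
  simp only [proj_apply, hv _, smul_smul, ← Finset.sum_smul, h1]
  split_ifs
  · rw [inv_mul_cancel₀ (card_ne_zero' ), one_smul]
  · simp

theorem proj_self {x : X} {v : V} (hv : v ∈ S.weightSpace ρ x) : S.proj ρ x v = v := by
  rw [S.proj_of_mem hv, if_pos rfl]

open Classical in
theorem sum_char [Fintype X] (a : A) :
    ∑ x, S.char x a = if a = 0 then (Fintype.card A : ℂ) else 0 := by
  rw [← AddChar.sum_apply_eq_ite a]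
  exact S.bijective_char.sum_comp (fun ψ : AddChar A ℂ => ψ a)

variable (ρ)

theorem sum_proj [Fintype X] (v : V) : ∑ x, S.proj ρ x v = v := by
  classical
  simp only [proj_apply, ← Finset.smul_sum]
  rw [Finset.sum_comm]
  simp only [← Finset.sum_smul, S.sum_char, neg_eq_zero, ite_smul, zero_smul]
  rw [Finset.sum_ite_eq' Finset.univ 0, if_pos (Finset.mem_univ _), S.α_zero, map_one,
    smul_smul, inv_mul_cancel₀ card_ne_zero', one_smul, Module.End.one_apply]

theorem map_proj [Fintype X] (h : H) (x : X) (v : V) :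
    ρ (S.β h) (S.proj ρ x v) = S.proj ρ (h • x) (ρ (S.β h) v) := by
  classical
  conv_rhs => rw [← S.sum_proj ρ v, map_sum, map_sum]
  simp only [S.proj_of_mem (S.smul_mem_weightSpace (S.proj_mem ρ _ v) h), smul_left_cancel_iff]
  simp

/-- The component of `χ : G → ℂ` at the character `x` of `A`, as a function on `H`: the Fourier
coefficient at `x` of `a ↦ χ (a h)`. -/
noncomputable def component (x : X) (χ : G → ℂ) (h : H) : ℂ :=
  (Fintype.card A : ℂ)⁻¹ * ∑ a, S.char x (-a) * χ (S.α a * S.β h)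

theorem apply_eq_sum_component [Fintype X] (χ : G → ℂ) (b : A) (h : H) :
    χ (S.α b * S.β h) = ∑ x, S.char x b * S.component x χ h := by
  classical
  have : ∀ x, S.char x b * S.component x χ h =
      (Fintype.card A : ℂ)⁻¹ * ∑ a, S.char x (b - a) * χ (S.α a * S.β h) := fun x => by
    rw [component, mul_left_comm, Finset.mul_sum]
    simp only [sub_eq_add_neg, AddChar.map_add_eq_mul, mul_assoc]
  simp only [this, ← Finset.mul_sum]
  rw [Finset.sum_comm]
  simp only [← Finset.sum_mul, S.sum_char, sub_eq_zero, ite_mul, zero_mul]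
  rw [Finset.sum_ite_eq Finset.univ b, if_pos (Finset.mem_univ _), ← mul_assoc,
    inv_mul_cancel₀ card_ne_zero', one_mul]

theorem ext_component [Fintype X] {χ ψ : G → ℂ}
    (h : ∀ x h, S.component x χ h = S.component x ψ h) : χ = ψ := by
  ext g
  obtain ⟨a, k, rfl⟩ := S.exists_eq' g
  simp only [S.apply_eq_sum_component, h]

theorem component_character (x : X) (h : H) :
    S.component x ρ.character h = LinearMap.trace ℂ V (S.proj ρ x * ρ (S.β h)) := by
  simp only [component, Representation.character, proj, smul_mul_assoc, Finset.sum_mul, map_smul,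
    map_sum, map_mul, smul_eq_mul]

theorem sum_component_one [Fintype X] (χ : G → ℂ) : χ 1 = ∑ x, S.component x χ 1 := by
  have := S.apply_eq_sum_component χ 0 1
  simpa [S.α_zero] using this

theorem component_smul [Fintype X] (k : H) (x : X) (h : H) :
    S.component (k • x) ρ.character h = S.component x ρ.character (k⁻¹ * h * k) := by
  have h1 : S.proj ρ (k • x) = ρ (S.β k) * (S.proj ρ x * ρ (S.β k⁻¹)) := by
    ext v
    simp only [Module.End.mul_apply, S.map_proj]
    rw [← Module.End.mul_apply (ρ (S.β k)), ← map_mul, ← map_mul]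
    simp
  rw [component_character, component_character, h1, mul_assoc, LinearMap.trace_mul_comm]
  simp only [mul_assoc, map_mul]

theorem component_eq_zero [Fintype X] {x : X} {h : H} (hx : h • x ≠ x) :
    S.component x ρ.character h = 0 := by
  classical
  have h1 : S.proj ρ x * S.proj ρ x = S.proj ρ x := by
    ext v; exact S.proj_self (S.proj_mem ρ x v)
  rw [component_character, ← h1, mul_assoc, LinearMap.trace_mul_comm]
  convert map_zero (LinearMap.trace ℂ V)
  ext v
  simp only [Module.End.mul_apply, S.map_proj]
  rw [← S.map_proj, S.proj_of_mem (S.smul_mem_weightSpace (S.proj_mem ρ x v) h),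
    if_neg (Ne.symm hx), LinearMap.zero_apply]

theorem character_weightRep [FiniteDimensional ℂ V] (x : X) (k : stabilizer H x) :
    (S.weightRep ρ x).character k = S.component x ρ.character k := by
  rw [component_character, ← LinearMap.trace_restrict_eq_of_forall_mem (S.weightSpace ρ x)
    (S.proj ρ x * ρ (S.β k)) (fun v => S.proj_mem ρ x _)]
  unfold Representation.character
  congr 1
  ext v
  have := S.smul_mem_weightSpace v.2 (k : H)
  rw [k.2] at this
  exact (S.proj_self this).symm

theorem component_one [FiniteDimensional ℂ V] (x : X) :
    S.component x ρ.character 1 = Module.finrank ℂ (S.weightSpace ρ x) := by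
  rw [← Representation.char_one (S.weightRep ρ x), character_weightRep]
  rfl

theorem component_one_ne_zero_iff [FiniteDimensional ℂ V] (x : X) :
    S.component x ρ.character 1 ≠ 0 ↔ S.weightSpace ρ x ≠ ⊥ := by
  rw [component_one, Nat.cast_ne_zero, Ne, Submodule.finrank_eq_zero]

variable {ρ}

/-- The weights of an irreducible representation form one orbit. -/
theorem mem_orbit_of_weightSpace_ne_bot (hρ : ρ.IsIrreducible) {x y : X}
    (hx : S.weightSpace ρ x ≠ ⊥) (hy : S.weightSpace ρ y ≠ ⊥) : y ∈ orbit H x := by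
  classical
  by_contra hxy
  refine hy (eq_bot_iff.2 fun v hv => ?_)
  have hle : ⨆ h, (S.weightSpace ρ x).map (ρ (S.β h)) ≤ LinearMap.ker (S.proj ρ y) := by
    refine iSup_le fun h => ?_
    rintro _ ⟨w, hw, rfl⟩
    rw [LinearMap.mem_ker, S.proj_of_mem (S.smul_mem_weightSpace hw h), if_neg]
    rintro rfl
    exact hxy ⟨h, rfl⟩
  rw [S.iSup_map_eq_top hρ le_rfl hx] at hle
  rw [Submodule.mem_bot, ← S.proj_self hv]
  exact hle (Submodule.mem_top)

theorem weightRep_isIrreducible (hρ : ρ.IsIrreducible) {x : X} (hx : S.weightSpace ρ x ≠ ⊥) :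
    (S.weightRep ρ x).IsIrreducible := by
  classical
  rw [isIrreducible_iff_forall_submodule]
  refine ⟨Submodule.nontrivial_iff_ne_bot.2 hx, fun U hU => ?_⟩
  by_cases h0 : U = ⊥
  · exact Or.inl h0
  right
  have h0' : U.map (S.weightSpace ρ x).subtype ≠ ⊥ := fun h => h0 <|
    Submodule.map_injective_of_injective (Submodule.injective_subtype _)
      (h.trans (Submodule.map_bot _).symm)
  have htop := S.iSup_map_eq_top hρ (Submodule.map_subtype_le _ _) h0'
  have hle : ⨆ h, (U.map (S.weightSpace ρ x).subtype).map (ρ (S.β h)) ≤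
      (U.map (S.weightSpace ρ x).subtype).comap (S.proj ρ x) := by
    refine iSup_le fun h => ?_
    rintro _ ⟨_, ⟨u, hu, rfl⟩, rfl⟩
    rw [Submodule.mem_comap, Submodule.subtype_apply,
      S.proj_of_mem (S.smul_mem_weightSpace u.2 h)]
    split_ifs with hk
    · exact ⟨_, hU ⟨h, hk.symm⟩ u hu, rfl⟩
    · exact Submodule.zero_mem _
  rw [htop] at hle
  rw [eq_top_iff]
  intro v _
  obtain ⟨u, hu, huv⟩ := hle (Submodule.mem_top (x := (v : V)))
  rw [S.proj_self v.2] at huv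
  rwa [← Subtype.ext huv]

end Weights

section Characters

variable [Fintype A]

/-- The component at a weight is the character of the stabilizer on the weight space. -/
theorem component_mem_Irr {χ : G → ℂ} (hχ : χ ∈ Irr G) {x : X} (hx : S.component x χ 1 ≠ 0) :
    (fun k : stabilizer H x => S.component x χ k) ∈ Irr (stabilizer H x) := by
  obtain ⟨V, _, _, _, ρ, hρ, rfl⟩ := hχ
  rw [S.component_one_ne_zero_iff] at hx
  convert character_mem_Irr (S.weightRep_isIrreducible hρ hx) using 1
  ext k
  rw [S.character_weightRep]

theorem mem_orbit_of_component_ne_zero {χ : G → ℂ} (hχ : χ ∈ Irr G) {x y : X}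
    (hx : S.component x χ 1 ≠ 0) (hy : S.component y χ 1 ≠ 0) : y ∈ orbit H x := by
  obtain ⟨V, _, _, _, ρ, hρ, rfl⟩ := hχ
  rw [S.component_one_ne_zero_iff] at hx hy
  exact S.mem_orbit_of_weightSpace_ne_bot hρ hx hy

variable [Fintype X]

theorem component_smul_of_mem_Irr {χ : G → ℂ} (hχ : χ ∈ Irr G) (k : H) (x : X) (h : H) :
    S.component (k • x) χ h = S.component x χ (k⁻¹ * h * k) := by
  obtain ⟨V, _, _, _, ρ, hρ, rfl⟩ := hχ
  exact S.component_smul ρ k x h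

theorem component_eq_zero_of_mem_Irr {χ : G → ℂ} (hχ : χ ∈ Irr G) {x : X} {h : H}
    (hx : h • x ≠ x) : S.component x χ h = 0 := by
  obtain ⟨V, _, _, _, ρ, hρ, rfl⟩ := hχ
  exact S.component_eq_zero ρ hx

theorem component_eq_zero_of_one {χ : G → ℂ} (hχ : χ ∈ Irr G) {x : X}
    (hx : S.component x χ 1 = 0) (h : H) : S.component x χ h = 0 := by
  by_cases hh : h • x = x
  · obtain ⟨V, _, _, _, ρ, hρ, rfl⟩ := hχ
    have : S.weightSpace ρ x = ⊥ := by
      by_contra hb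
      exact (S.component_one_ne_zero_iff ρ x).2 hb hx
    rw [component_character]
    convert map_zero (LinearMap.trace ℂ V)
    ext v
    have hv := S.proj_mem ρ x (ρ (S.β h) v)
    rw [this, Submodule.mem_bot] at hv
    exact hv
  · exact S.component_eq_zero_of_mem_Irr hχ hh

/-- The weight spaces of the weights, which form one orbit, are conjugate and add up to the whole
representation. -/
theorem apply_one_eq_card_orbit_mul {χ : G → ℂ} (hχ : χ ∈ Irr G) {x : X}
    (hx : S.component x χ 1 ≠ 0) : χ 1 = (orbit H x).ncard * S.component x χ 1 := by
  classical
  have hterm : ∀ y, S.component y χ 1 = if y ∈ orbit H x then S.component x χ 1 else 0 := by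
    intro y
    split_ifs with hy
    · obtain ⟨k, rfl⟩ := hy
      simp [S.component_smul_of_mem_Irr hχ]
    · by_contra h
      exact hy (S.mem_orbit_of_component_ne_zero hχ hx h)
  rw [S.sum_component_one χ, Finset.sum_congr rfl fun y _ => hterm y]
  rw [← Finset.sum_filter, Finset.sum_const, nsmul_eq_mul, Set.ncard_eq_toFinset_card']
  congr 3
  ext; simp

/-- An irreducible character is determined by its component at any one of its weights, because
the components at the other weights are conjugates. -/
theorem eq_of_component_eq {χ ψ : G → ℂ} (hχ : χ ∈ Irr G) (hψ : ψ ∈ Irr G) {x : X}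
    (hx : S.component x χ 1 ≠ 0)
    (h : ∀ k : stabilizer H x, S.component x χ k = S.component x ψ k) : χ = ψ := by
  have hx' : S.component x ψ 1 ≠ 0 := by
    rwa [show S.component x ψ 1 = S.component x χ 1 from (h 1).symm]
  have key : ∀ k, S.component x χ k = S.component x ψ k := fun k => by
    by_cases hk : k • x = x
    · exact h ⟨k, hk⟩
    · rw [S.component_eq_zero_of_mem_Irr hχ hk, S.component_eq_zero_of_mem_Irr hψ hk]
  refine S.ext_component fun y k => ?_
  by_cases hy : y ∈ orbit H x
  · obtain ⟨g, rfl⟩ := hy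
    simp only [S.component_smul_of_mem_Irr hχ, S.component_smul_of_mem_Irr hψ, key]
  · rw [S.component_eq_zero_of_one hχ, S.component_eq_zero_of_one hψ]
    · by_contra h0
      exact hy (S.mem_orbit_of_component_ne_zero hψ hx' h0)
    · by_contra h0
      exact hy (S.mem_orbit_of_component_ne_zero hχ hx h0)

end Characters

section Coinduction

variable {W : Type*} [AddCommGroup W] [Module ℂ W] {x : X}
  (σ : Representation ℂ (stabilizer H x) W)

/-- The functions `G → W` that are equivariant under left translation by the inertia group of `x`,
acting on `W` through `σ` and `x`. They form a subrepresentation for right translation: the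
coinduced representation. -/
def coinduced : Subrepresentation
    ({ toFun := fun g => LinearMap.funLeft ℂ W (· * g)
       map_one' := by ext; simp
       map_mul' := fun a b => by ext; simp [mul_assoc] } : Representation ℂ G (G → W)) where
  toSubmodule :=
    { carrier := {f | ∀ (k : stabilizer H x) a g,
        f (S.β k * S.α a * g) = S.char x a • σ k (f g)}
      add_mem' := fun {f f'} hf hf' k a g => by simp [hf k a g, hf' k a g]
      zero_mem' := fun k a g => by simp
      smul_mem' := fun c f hf k a g => by simp [hf k a g, smul_comm c] }
  apply_mem_toSubmodule g f hf k a g' := by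
    have := hf k a (g' * g)
    simpa [mul_assoc] using this

theorem mem_coinduced {f : G → W} : f ∈ (S.coinduced σ).toSubmodule ↔
    ∀ (k : stabilizer H x) a g, f (S.β k * S.α a * g) = S.char x a • σ k (f g) := Iff.rfl

/-- The coinduced representation contains, for each `w`, the function that is supported on the
inertia group and takes the value `w` at `1`. -/
theorem exists_mem_coinduced (w : W) : ∃ f ∈ (S.coinduced σ).toSubmodule, f 1 = w := by
  classical
  let e := Equiv.ofBijective _ S.bijective_mul
  have he : ∀ h a, e.symm (S.β h * S.α a) = (h, a) := fun h a =>
    e.symm_apply_apply (h, a)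
  let f : G → W := fun g =>
    if hg : (e.symm g).1 ∈ stabilizer H x then
      S.char x (e.symm g).2 • σ ⟨(e.symm g).1, hg⟩ w else 0
  have hf : ∀ h a, f (S.β h * S.α a) =
      if hg : h ∈ stabilizer H x then S.char x a • σ ⟨h, hg⟩ w else 0 := fun h a => by
    simp only [f, he]
  refine ⟨f, ?_, ?_⟩
  · rw [mem_coinduced]
    intro k a g
    obtain ⟨h, b, rfl⟩ := S.exists_eq g
    have h1 : S.β k * S.α a * (S.β h * S.α b) = S.β (k * h) * S.α (S.act h a + b) := by
      rw [S.α_add, map_mul, ← mul_assoc, mul_assoc (S.β k), S.comm]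
      simp only [mul_assoc]
    rw [h1, hf, hf]
    by_cases hh : h ∈ stabilizer H x
    · rw [dif_pos hh, dif_pos (mul_mem k.2 hh), AddChar.map_add_eq_mul, ← S.char_smul,
        show h • x = x from hh, map_smul, smul_smul, ← Module.End.mul_apply, ← map_mul σ]
      rfl
    · rw [dif_neg hh, dif_neg (fun h' => hh ((Subgroup.mul_mem_cancel_left _ k.2).1 h')), map_zero,
        smul_zero]
  · have := hf 1 0
    rw [map_one, S.α_zero, mul_one, dif_pos (one_mem _)] at this
    rw [this]
    simp [show (⟨1, one_mem _⟩ : stabilizer H x) = 1 from rfl]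

variable {V : Type*} [AddCommGroup V] [Module ℂ V] [FiniteDimensional ℂ V]
  {ρ : Representation ℂ G V} {σ}

/-- An irreducible representation of `G` that maps nontrivially and equivariantly to an irreducible
representation of the inertia group of `x` has this representation as its component at `x`, by
Schur's lemma. -/
theorem component_eq_of_equivariant [FiniteDimensional ℂ W] [Fintype A] [Fintype X]
    (hρ : ρ.IsIrreducible) (hσ : σ.IsIrreducible) (φ : V →ₗ[ℂ] W) (h0 : φ ≠ 0)
    (hφ : ∀ (k : stabilizer H x) a v, φ (ρ (S.β k * S.α a) v) = S.char x a • σ k (φ v))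
    (k : stabilizer H x) : S.component x ρ.character k = σ.character k := by
  have hφα : ∀ a v, φ (ρ (S.α a) v) = S.char x a • φ v := fun a v => by
    simpa using hφ 1 a v
  have hφβ : ∀ (k : stabilizer H x) v, φ (ρ (S.β k) v) = σ k (φ v) := fun k v => by
    simpa [S.α_zero] using hφ k 0 v
  have hother : ∀ y ≠ x, ∀ v ∈ S.weightSpace ρ y, φ v = 0 := fun y hy v hv => by
    by_contra hv0
    refine hy (S.bijective_char.1 (DFunLike.ext _ _ fun a => ?_))
    have h1 := hφα a v
    rw [hv, map_smul] at h1
    exact smul_left_injective ℂ hv0 h1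
  let ψ : Representation.IntertwiningMap (S.weightRep ρ x) σ :=
    { toLinearMap := φ.comp (S.weightSpace ρ x).subtype
      isIntertwining' := fun k => by ext v; exact hφβ k v }
  have hψ : ψ ≠ 0 := fun h => h0 <| by
    ext v
    rw [← S.sum_proj ρ v, map_sum, LinearMap.zero_apply]
    refine Finset.sum_eq_zero fun y _ => ?_
    by_cases hy : y = x
    · subst hy
      exact DFunLike.congr_fun h (⟨_, S.proj_mem ρ y v⟩ : S.weightSpace ρ y)
    · exact hother y hy _ (S.proj_mem ρ y v)
  have hx : S.weightSpace ρ x ≠ ⊥ := fun h => hψ <| by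
    ext v
    have : v = 0 := Subtype.ext ((Submodule.mem_bot ℂ).1 (h ▸ v.2))
    rw [this, map_zero, map_zero]
  have := S.weightRep_isIrreducible hρ hx
  have hb := (Representation.IsIrreducible.bijective_or_eq_zero ψ).resolve_right hψ
  rw [← S.character_weightRep, Representation.char_iso (ψ.ofBijective hb)]

/-- Any irreducible constituent of the coinduced representation has the prescribed component. -/
theorem exists_mem_Irr_component_eq [Finite G] [Fintype A] [Fintype X] {x : X}
    {ψ : stabilizer H x → ℂ} (hψ : ψ ∈ Irr (stabilizer H x)) :
    ∃ χ ∈ Irr G, ∀ k : stabilizer H x, S.component x χ k = ψ k := by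
  obtain ⟨W, _, _, _, σ, hσ, rfl⟩ := hψ
  have hW := ((isIrreducible_iff_forall_submodule σ).1 hσ).1
  obtain ⟨w, hw⟩ := exists_ne (0 : W)
  obtain ⟨f, hf, hf1⟩ := S.exists_mem_coinduced σ w
  have : Nontrivial (S.coinduced σ).toSubmodule :=
    ⟨⟨f, hf⟩, 0, fun h => hw <| hf1.symm.trans (congrFun (congrArg Subtype.val h) 1)⟩
  obtain ⟨U, hU⟩ := exists_irreducible_subrepresentation (S.coinduced σ).toRepresentation
  -- The equivariant map is the evaluation at `1`.
  let φ : U.toSubmodule →ₗ[ℂ] W :=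
    LinearMap.proj 1 ∘ₗ (S.coinduced σ).toSubmodule.subtype ∘ₗ U.toSubmodule.subtype
  have hval : ∀ g (u : U.toSubmodule), φ (U.toRepresentation g u) = u.1.1 g := fun g u => by
    change u.1.1 (1 * g) = _
    rw [one_mul]
  refine ⟨_, character_mem_Irr hU, S.component_eq_of_equivariant hU hσ φ (fun h => ?_) ?_⟩
  · obtain ⟨u, hu⟩ := @exists_ne _ ((isIrreducible_iff_forall_submodule _).1 hU).1 0
    refine hu (Subtype.ext (Subtype.ext (funext fun g => ?_)))
    rw [← hval, h]; rfl
  · intro k a u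
    rw [hval]
    have := (S.mem_coinduced σ).1 u.1.2 k a 1
    rwa [mul_one] at this

end Coinduction

section Counting

variable [Finite G] [Fintype A] [Fintype X]

/-- Taking the component at `x` is a bijection from the irreducible characters with weight `x` to
the irreducible characters of the stabilizer of `x`. -/
theorem ncard_Irr_over (x : X) (d : ℕ) :
    {χ | χ ∈ Irr G ∧ S.component x χ 1 ≠ 0 ∧ χ 1 = (((orbit H x).ncard * d : ℕ) : ℂ)}.ncard =
      numIrr d (stabilizer H x) := by
  have ho : ((orbit H x).ncard : ℂ) ≠ 0 := by
    rw [Nat.cast_ne_zero]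
    exact Set.ncard_ne_zero_of_mem (mem_orbit_self x)
  refine Set.ncard_congr (fun χ _ k => S.component x χ k) ?_ ?_ ?_
  · rintro χ ⟨hχ, hx, h1⟩
    refine ⟨S.component_mem_Irr hχ hx, ?_⟩
    rw [S.apply_one_eq_card_orbit_mul hχ hx, Nat.cast_mul] at h1
    exact mul_left_cancel₀ ho h1
  · rintro χ ψ ⟨hχ, hx, -⟩ ⟨hψ, -, -⟩ h
    exact S.eq_of_component_eq hχ hψ hx fun k => congrFun h k
  · rintro ψ ⟨hψ, hd⟩
    obtain ⟨χ, hχ, h⟩ := S.exists_mem_Irr_component_eq hψ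
    have h1 : S.component x χ 1 = d := (h 1).trans hd
    have hx : S.component x χ 1 ≠ 0 := by
      rw [show S.component x χ 1 = ψ 1 from h 1]
      obtain ⟨W, _, _, _, σ, hσ, rfl⟩ := hψ
      have := ((isIrreducible_iff_forall_submodule σ).1 hσ).1
      rw [Representation.char_one, Nat.cast_ne_zero]
      exact Module.finrank_pos.ne'
    refine ⟨χ, ⟨hχ, hx, ?_⟩, funext h⟩
    rw [S.apply_one_eq_card_orbit_mul hχ hx, h1, Nat.cast_mul]

/-- The irreducible characters of degree `k` of a split extension are counted by the irreducible
characters of the stabilizers of the characters of `A`, one for each orbit. Orbits whose size does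
not divide `k` may be left out. -/
theorem numIrr_eq_sum (S : SplitExtension G H A X) {ι : Type*} [Fintype ι] (t : ι → X) (k : ℕ)
    (hinj : ∀ i j, t i ∈ orbit H (t j) → i = j)
    (hcov : ∀ x, (orbit H x).ncard ∣ k → ∃ i, x ∈ orbit H (t i)) :
    numIrr k G = ∑ i, if (orbit H (t i)).ncard ∣ k then
      numIrr (k / (orbit H (t i)).ncard) (stabilizer H (t i)) else 0 := by
  classical
  have hdvd : ∀ χ ∈ Irr G, χ 1 = k → ∀ x, S.component x χ 1 ≠ 0 → (orbit H x).ncard ∣ k := by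
    intro χ hχ h1 x hx
    rw [S.apply_one_eq_card_orbit_mul hχ hx] at h1
    obtain ⟨V, _, _, _, ρ, hρ, rfl⟩ := hχ
    rw [S.component_one] at h1
    exact ⟨_, by exact_mod_cast h1.symm⟩
  have hU : {χ | χ ∈ Irr G ∧ χ 1 = (k : ℂ)} =
      ⋃ i, {χ | χ ∈ Irr G ∧ S.component (t i) χ 1 ≠ 0 ∧ χ 1 = (k : ℂ)} := by
    ext χ
    simp only [Set.mem_ofPred_eq, Set.mem_iUnion]
    refine ⟨fun ⟨hχ, h1⟩ => ?_, fun ⟨i, hχ, _, h1⟩ => ⟨hχ, h1⟩⟩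
    have h0 : χ 1 ≠ 0 := by
      obtain ⟨V, _, _, _, ρ, hρ, rfl⟩ := hχ
      have := ((isIrreducible_iff_forall_submodule ρ).1 hρ).1
      rw [Representation.char_one, Nat.cast_ne_zero]
      exact Module.finrank_pos.ne'
    rw [S.sum_component_one χ] at h0
    obtain ⟨x, -, hx⟩ := Finset.exists_ne_zero_of_sum_ne_zero h0
    obtain ⟨i, g, hg⟩ := hcov x (hdvd χ hχ h1 x hx)
    refine ⟨i, hχ, ?_, h1⟩
    have := S.component_smul_of_mem_Irr hχ g (t i) 1
    rw [show g • t i = x from hg, mul_one, inv_mul_cancel] at this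
    rwa [← this]
  rw [numIrr, hU, Set.ncard_iUnion_of_finite
    (fun i => (Irr_finite G).subset fun χ h => h.1), finsum_eq_sum_of_fintype]
  · refine Finset.sum_congr rfl fun i _ => ?_
    split_ifs with hk
    · rw [← S.ncard_Irr_over, Nat.mul_div_cancel' hk]
    · convert Set.ncard_empty (G → ℂ)
      rw [Set.eq_empty_iff_forall_notMem]
      rintro χ ⟨hχ, hx, h1⟩
      exact hk (hdvd χ hχ h1 _ hx)
  · intro i j hij
    rw [Function.onFun, Set.disjoint_left]
    rintro χ ⟨hχ, hi, -⟩ ⟨-, hj, -⟩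
    exact hij (hinj i j (S.mem_orbit_of_component_ne_zero hχ hj hi))

/-- Only the orbits of length `1` contribute to the characters of degree `1`. -/
theorem numIrr_one_eq_mul (S : SplitExtension G H A X) :
    numIrr 1 G = (fixedPoints H X).ncard * numIrr 1 H := by
  classical
  have h1 : ∀ x ∈ fixedPoints H X, (orbit H x).ncard = 1 := fun x hx => by
    rw [Set.ncard_eq_one]
    refine ⟨x, Set.eq_singleton_iff_unique_mem.2 ⟨mem_orbit_self x, ?_⟩⟩
    rintro _ ⟨g, rfl⟩
    exact hx g
  rw [S.numIrr_eq_sum (fun x : fixedPoints H X => (x : X)) 1]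
  · rw [Finset.sum_congr rfl (g := fun _ => numIrr 1 H), Finset.sum_const, Finset.card_univ,
      smul_eq_mul, ← Nat.card_eq_fintype_card, Nat.card_coe_set_eq]
    rintro ⟨x, hx⟩ -
    simp only [h1 x hx, dvd_refl, if_true, Nat.div_one]
    have : stabilizer H x = ⊤ := eq_top_iff.2 fun g _ => hx g
    rw [this]
    exact numIrr_congr Subgroup.topEquiv 1
  · rintro i ⟨j, hj⟩ ⟨g, hg⟩
    exact Subtype.ext (hg.symm.trans (hj g))
  · intro x hx
    rw [Nat.dvd_one, Set.ncard_eq_one] at hx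
    obtain ⟨y, hy⟩ := hx
    have hxy : x = y := by
      have := mem_orbit_self (M := H) x
      rwa [hy] at this
    refine ⟨⟨x, fun g => ?_⟩, mem_orbit_self x⟩
    have := mem_orbit x g
    rw [hy] at this
    exact (Set.mem_singleton_iff.1 this).trans hxy.symm

end Counting

end SplitExtension

/-! ### Pattern subgroups and their decomposition along the first row -/

/-- A matrix of unitriangular shape, as an element of the general linear group. -/
noncomputable def unitriangularGL {F : Type*} [Field F] {n : ℕ} (M : Matrix (Fin n) (Fin n) F)
    (h0 : ∀ i j : Fin n, j < i → M i j = 0) (h1 : ∀ i : Fin n, M i i = 1) : GL (Fin n) F :=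
  Matrix.GeneralLinearGroup.mkOfDetNeZero M <| by
    rw [Matrix.det_of_isUpperTriangular (fun i j hij => h0 i j hij)]
    simp [h1]

theorem unitriangularGL_mem {F : Type*} [Field F] {n : ℕ} (M : Matrix (Fin n) (Fin n) F)
    (h0 : ∀ i j : Fin n, j < i → M i j = 0) (h1 : ∀ i : Fin n, M i i = 1) :
    unitriangularGL M h0 h1 ∈ unitriangular F n := ⟨h0, h1⟩

theorem unitriangularGL_val {F : Type*} [Field F] {n : ℕ} (M : Matrix (Fin n) (Fin n) F)
    (h0 : ∀ i j : Fin n, j < i → M i j = 0) (h1 : ∀ i : Fin n, M i i = 1) :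
    (unitriangularGL M h0 h1).val = M := rfl

/-- The subgroup of `U_n` of the matrices whose column `i` vanishes in the rows from `s` to
`i - 1`, where rows and columns are numbered from `0`. It is all of `U_n` if `i ≤ s` or `n ≤ i`. -/
def patternSubgroup (F : Type*) [Field F] (n s i : ℕ) : Subgroup (GL (Fin n) F) where
  carrier := {A | A ∈ unitriangular F n ∧
    ∀ a b : Fin n, b.val = i → s ≤ a.val → a < b → A.val a b = 0}
  one_mem' := ⟨one_mem _, fun a b _ _ h => by simp [h.ne]⟩
  mul_mem' := by
    rintro A B ⟨hA, hA'⟩ ⟨hB, hB'⟩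
    refine ⟨mul_mem hA hB, fun a b hb ha hab => ?_⟩
    rw [Units.val_mul, Matrix.mul_apply]
    refine Finset.sum_eq_zero fun k _ => ?_
    rcases lt_or_ge k a with hk | hk
    · rw [hA.1 a k hk, zero_mul]
    · rcases lt_trichotomy k b with hkb | hkb | hkb
      · rw [hB' k b hb (ha.trans hk) hkb, mul_zero]
      · rw [hkb, hA' a b hb ha hab, zero_mul]
      · rw [hB.1 k b hkb, mul_zero]
  inv_mem' := by
    rintro A ⟨hA, hA'⟩
    have hB : A⁻¹ ∈ unitriangular F n := inv_mem hA
    refine ⟨hB, fun a b hb ha hab => ?_⟩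
    have h : ((A⁻¹).val * A.val) a b = 0 := by
      rw [← Units.val_mul, inv_mul_cancel]; simp [hab.ne]
    rw [Matrix.mul_apply, Finset.sum_eq_single b, hA.2, mul_one] at h
    · exact h
    · intro k _ hk
      rcases lt_or_ge k a with hka | hka
      · rw [hB.1 a k hka, zero_mul]
      · rcases lt_or_gt_of_ne hk with hk | hk
        · rw [hA' k b hb (ha.trans hka) hk, mul_zero]
        · rw [hA.1 k b hk, mul_zero]
    · simp

section Pattern

variable {F : Type*} [Field F] {n m s i : ℕ}

theorem mem_patternSubgroup {A : GL (Fin n) F} : A ∈ patternSubgroup F n s i ↔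
    A ∈ unitriangular F n ∧ ∀ a b : Fin n, b.val = i → s ≤ a.val → a < b → A.val a b = 0 :=
  Iff.rfl

theorem patternSubgroup_eq_unitriangular (h : i ≤ s ∨ n ≤ i) :
    patternSubgroup F n s i = unitriangular F n := by
  ext A
  rw [mem_patternSubgroup]
  refine ⟨fun h => h.1, fun hA => ⟨hA, fun a b hb ha hab => ?_⟩⟩
  have := b.2
  rw [Fin.lt_def] at hab
  omega

theorem subgroupQ_one_three_eq : subgroupQ F n 1 3 = patternSubgroup F n 1 2 := by
  ext A
  refine ⟨fun h => ⟨h.1, fun a b hb ha hab => h.2.2 a b (by omega) hab (by omega)⟩,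
    fun h => ⟨h.1, fun y c hc hy => ?_, fun x c hc hx hx1 => h.2 x c (by omega) (by omega) hx⟩⟩
  rw [Fin.lt_def] at hy
  omega

variable (F m s i)

/-- The positions of the first row of `patternSubgroup F (m + 1) s i` that are not forced to
vanish; the position `b` stands for column `b + 1`. -/
abbrev FreePos := {b : Fin m // ¬ (s = 0 ∧ b.val + 1 = i)}

/-- The characters of the group of first rows of `patternSubgroup F (m + 1) s i`, as column
vectors. -/
def DualRow := FreePos m s i → F

noncomputable instance [Finite F] : Fintype (DualRow F m s i) :=
  have : Finite (FreePos m s i → F) := inferInstance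
  @Fintype.ofFinite _ this

variable {F m s i}

/-- The group of first rows is stable under the lower right block. -/
theorem apply_eq_zero_of_free {B : GL (Fin m) F} (hB : B ∈ patternSubgroup F m (s - 1) (i - 1))
    (a : FreePos m s i) {c : Fin m} (hc : s = 0 ∧ c.val + 1 = i) : B.val a c = 0 := by
  rcases lt_trichotomy a.1 c with h | h | h
  · exact hB.2 a c (by omega) (by omega) h
  · exact absurd (h ▸ hc) a.2
  · exact hB.1.1 a c h

theorem sum_freePos (f : Fin m → F) (hf : ∀ b : Fin m, s = 0 ∧ b.val + 1 = i → f b = 0) :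
    ∑ b : FreePos m s i, f b.1 = ∑ b, f b := by
  rw [← Fintype.sum_subtype_add_sum_subtype (fun b : Fin m => ¬ (s = 0 ∧ b.val + 1 = i)) f]
  rw [Finset.sum_eq_zero (f := fun b : {b : Fin m // ¬ ¬ (s = 0 ∧ b.val + 1 = i)} => f b), add_zero]
  exact fun b _ => hf b (not_not.1 b.2)

variable (F m s i)

/-- Restriction of a lower right block to the free positions. -/
def restrictFree :
    patternSubgroup F m (s - 1) (i - 1) →* Matrix (FreePos m s i) (FreePos m s i) F where
  toFun B := B.1.val.submatrix Subtype.val Subtype.val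
  map_one' := by ext a b; simp [Matrix.one_apply, Subtype.ext_iff]
  map_mul' B C := by
    ext a b
    simp only [Matrix.submatrix_apply, Matrix.mul_apply, Subgroup.coe_mul, Units.val_mul]
    refine (sum_freePos (fun k => B.1.val a k * C.1.val k b) fun k hk => ?_).symm
    rw [apply_eq_zero_of_free B.2 a hk, zero_mul]

noncomputable instance : MulAction (patternSubgroup F m (s - 1) (i - 1)) (DualRow F m s i) where
  smul B x := (restrictFree F m s i B).mulVec x
  one_smul x := by
    change (restrictFree F m s i 1).mulVec x = x
    rw [map_one]
    exact Matrix.one_mulVec (x : FreePos m s i → F)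
  mul_smul B C x := by
    change (restrictFree F m s i (B * C)).mulVec x =
      (restrictFree F m s i B).mulVec ((restrictFree F m s i C).mulVec x)
    rw [map_mul]
    exact (Matrix.mulVec_mulVec (x : FreePos m s i → F) _ _).symm

variable {F m s i}

theorem dualRow_smul_apply (B : patternSubgroup F m (s - 1) (i - 1)) (x : DualRow F m s i)
    (a : FreePos m s i) : (B • x : DualRow F m s i) a = ∑ b, B.1.val a.1 b.1 * x b := rfl

/-- The matrix of size `m + 1` with first column `(1, 0, …, 0)`, first row `(1, v)` and lower right
block `B`. -/
def rowBlock (v : Fin m → F) (B : Matrix (Fin m) (Fin m) F) :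
    Matrix (Fin (m + 1)) (Fin (m + 1)) F :=
  Matrix.of (Fin.cons (Fin.cons 1 v) fun a => Fin.cons 0 (B a))

theorem rowBlock_mul (v w : Fin m → F) (B C : Matrix (Fin m) (Fin m) F) :
    rowBlock v B * rowBlock w C = rowBlock (w + Matrix.vecMul v C) (B * C) := by
  ext a b
  rw [Matrix.mul_apply, Fin.sum_univ_succ]
  cases a using Fin.cases <;> cases b using Fin.cases <;>
    simp [rowBlock, Matrix.mul_apply, Matrix.vecMul, dotProduct]

/-- Extension by zero of a vector on the free positions. -/
def extendFree (v : FreePos m s i → F) (b : Fin m) : F :=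
  if h : ¬ (s = 0 ∧ b.val + 1 = i) then v ⟨b, h⟩ else 0

theorem extendFree_coe (v : FreePos m s i → F) (b : FreePos m s i) : extendFree v b.1 = v b :=
  dif_pos b.2

theorem extendFree_of_not (v : FreePos m s i → F) {b : Fin m} (h : s = 0 ∧ b.val + 1 = i) :
    extendFree v b = 0 := dif_neg (not_not.2 h)

theorem sum_extendFree (v : FreePos m s i → F) (f : Fin m → F) :
    ∑ b, extendFree v b * f b = ∑ b, v b * f b.1 := by
  rw [← sum_freePos (s := s) (i := i)]
  · simp only [extendFree_coe]
  · intro b hb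
    rw [extendFree_of_not v hb, zero_mul]

/-- The element of the pattern subgroup with given first row and lower right block. -/
noncomputable def rowElem (v : FreePos m s i → F) (B : patternSubgroup F m (s - 1) (i - 1)) :
    patternSubgroup F (m + 1) s i :=
  ⟨unitriangularGL (rowBlock (extendFree v) B.1.val)
    (fun a b h => by
      cases a using Fin.cases with
      | zero => exact absurd h (Fin.not_lt_zero _)
      | succ a =>
        cases b using Fin.cases with
        | zero => simp [rowBlock]
        | succ b => simpa [rowBlock] using B.2.1.1 a b (Fin.succ_lt_succ_iff.1 h))
    (fun a => by
      cases a using Fin.cases with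
      | zero => simp [rowBlock]
      | succ a => simpa [rowBlock] using B.2.1.2 a), by
    refine ⟨unitriangularGL_mem _ _ _, fun a b hb ha hab => ?_⟩
    · rw [unitriangularGL_val]
      cases b using Fin.cases with
      | zero => exact absurd hab (Fin.not_lt_zero _)
      | succ b =>
        cases a using Fin.cases with
        | zero =>
          exact extendFree_of_not v ⟨by simpa using ha, by simpa using hb⟩
        | succ a =>
          refine B.2.2 a b ?_ ?_ (Fin.succ_lt_succ_iff.1 hab)
          · simp at hb; omega
          · simp at ha; omega⟩

theorem rowElem_mul (v w : FreePos m s i → F) (B C : patternSubgroup F m (s - 1) (i - 1)) :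
    rowElem v B * rowElem w C =
      rowElem (w + Matrix.vecMul v (restrictFree F m s i C)) (B * C) := by
  apply Subtype.ext
  apply Units.ext
  change rowBlock _ _ * rowBlock _ _ = rowBlock _ _
  rw [rowBlock_mul]
  congr 1
  ext b
  by_cases hb : s = 0 ∧ b.val + 1 = i
  · rw [extendFree_of_not _ hb, Pi.add_apply, extendFree_of_not _ hb, zero_add]
    change ∑ a, extendFree v a * C.1.val a b = 0
    rw [sum_extendFree v fun a => C.1.val a b]
    exact Finset.sum_eq_zero fun a _ => by rw [apply_eq_zero_of_free C.2 a hb, mul_zero]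
  · have h1 := extendFree_coe (w + Matrix.vecMul v (restrictFree F m s i C)) ⟨b, hb⟩
    have h2 := extendFree_coe w ⟨b, hb⟩
    rw [h1, Pi.add_apply, Pi.add_apply, h2]
    congr 1
    exact sum_extendFree v fun a => C.1.val a b

theorem rowElem_injective {v w : FreePos m s i → F} {B C : patternSubgroup F m (s - 1) (i - 1)}
    (h : rowElem v B = rowElem w C) : v = w ∧ B = C := by
  have hM : rowBlock (extendFree v) B.1.val = rowBlock (extendFree w) C.1.val :=
    congrArg (fun A => A.1.val) h
  constructor
  · ext b
    have := congrFun (congrFun hM 0) b.1.succ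
    simpa [rowBlock, extendFree_coe] using this
  · apply Subtype.ext
    apply Units.ext
    ext a b
    have := congrFun (congrFun hM a.succ) b.succ
    simpa [rowBlock] using this

theorem exists_rowElem_eq (A : patternSubgroup F (m + 1) s i) :
    ∃ v B, A = rowElem (s := s) (i := i) v B := by
  have hA := A.2
  refine ⟨fun b => A.1.val 0 b.1.succ,
    ⟨unitriangularGL (A.1.val.submatrix Fin.succ Fin.succ)
      (fun a b h => hA.1.1 _ _ (Fin.succ_lt_succ_iff.2 h)) (fun a => hA.1.2 _),
      unitriangularGL_mem _ _ _, fun a b hb ha hab => ?_⟩, ?_⟩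
  · have hab' := hab
    rw [Fin.lt_def] at hab'
    refine hA.2 a.succ b.succ ?_ ?_ (Fin.succ_lt_succ_iff.2 hab) <;>
    · rw [Fin.val_succ]
      omega
  · apply Subtype.ext
    apply Units.ext
    ext a b
    change _ = rowBlock _ _ a b
    cases a using Fin.cases with
    | zero =>
      cases b using Fin.cases with
      | zero => simpa [rowBlock] using hA.1.2 0
      | succ b =>
        by_cases hb : s = 0 ∧ b.val + 1 = i
        · have h1 : A.1.val 0 b.succ = 0 :=
            hA.2 0 b.succ hb.2 (by simp [hb.1]) (Fin.succ_pos b)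
          rw [h1]
          exact (extendFree_of_not (fun b : FreePos m s i => A.1.val 0 b.1.succ) hb).symm
        · exact (extendFree_coe (fun b : FreePos m s i => A.1.val 0 b.1.succ) ⟨b, hb⟩).symm
    | succ a =>
      cases b using Fin.cases with
      | zero => simpa [rowBlock] using hA.1.1 a.succ 0 (Fin.succ_pos a)
      | succ b => rfl

theorem exists_addChar_ne_one (F : Type*) [Field F] [Finite F] : ∃ ψ : AddChar F ℂ, ψ ≠ 1 := by
  obtain ⟨ψ, h⟩ := AddChar.exists_apply_ne_zero.2 (one_ne_zero (α := F))
  exact ⟨ψ, fun h1 => h (by rw [h1]; rfl)⟩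

/-- The character `v ↦ ψ (∑ b, v b * x b)` of the group of first rows. -/
noncomputable def dualRowChar (ψ : AddChar F ℂ) (x : DualRow F m s i) :
    AddChar (FreePos m s i → F) ℂ where
  toFun v := ψ (∑ b, v b * x b)
  map_zero_eq_one' := by simp
  map_add_eq_mul' v w := by
    simp only [Pi.add_apply, add_mul, Finset.sum_add_distrib, AddChar.map_add_eq_mul]

theorem dualRowChar_apply (ψ : AddChar F ℂ) (x : DualRow F m s i) (v : FreePos m s i → F) :
    dualRowChar ψ x v = ψ (∑ b, v b * x b) := rfl

theorem dualRowChar_bijective [Finite F] {ψ : AddChar F ℂ} (hψ : ψ ≠ 1) :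
    Function.Bijective (dualRowChar ψ : DualRow F m s i → _) := by
  classical
  have := Fintype.ofFinite F
  rw [Fintype.bijective_iff_injective_and_card]
  constructor
  · intro x y h
    refine funext fun b => ?_
    refine AddChar.to_mulShift_inj_of_isPrimitive (AddChar.IsPrimitive.of_ne_one hψ) ?_
    ext c
    have := DFunLike.congr_fun h (Pi.single b c)
    simpa [dualRowChar_apply, AddChar.mulShift_apply, Pi.single_apply, mul_comm] using this
  · have h1 := AddChar.card_eq (α := FreePos m s i → F)
    rw [← Nat.card_eq_fintype_card, ← Nat.card_eq_fintype_card] at h1 ⊢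
    exact h1.symm

/-- The group with pattern `(s, i)` in size `m + 1` is the semidirect product of its lower right
block and the group of its first rows. -/
noncomputable def rowExtension [Finite F] (ψ : AddChar F ℂ) (hψ : ψ ≠ 1) :
    SplitExtension (patternSubgroup F (m + 1) s i) (patternSubgroup F m (s - 1) (i - 1))
      (FreePos m s i → F) (DualRow F m s i) where
  α v := rowElem v 1
  β := MonoidHom.mk' (fun B => rowElem 0 B) fun B C => by
    rw [rowElem_mul, Matrix.zero_vecMul, add_zero]
  act B := (Matrix.vecMulLinear (restrictFree F m s i B)).toAddMonoidHom
  char := dualRowChar ψ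
  α_add v w := by
    rw [rowElem_mul, map_one, Matrix.vecMul_one, mul_one, add_comm v w]
  comm v B := by
    simp only [MonoidHom.mk'_apply, rowElem_mul, one_mul, mul_one, Matrix.zero_vecMul, add_zero,
      zero_add]
    rfl
  bijective_mul := by
    have h : ∀ (B : patternSubgroup F m (s - 1) (i - 1)) (v : FreePos m s i → F),
        rowElem 0 B * rowElem v 1 = rowElem v B := fun B v => by
      rw [rowElem_mul, Matrix.zero_vecMul, add_zero, mul_one]
    constructor
    · rintro ⟨B, v⟩ ⟨C, w⟩ hBC
      simp only [MonoidHom.mk'_apply, h] at hBC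
      obtain ⟨h1, h2⟩ := rowElem_injective hBC
      rw [h1, h2]
    · intro A
      obtain ⟨v, B, rfl⟩ := exists_rowElem_eq A
      exact ⟨(B, v), h B v⟩
  bijective_char := dualRowChar_bijective hψ
  char_smul B x v := congrArg ψ (Matrix.dotProduct_mulVec v (restrictFree F m s i B) x)

end Pattern

/-! ### Orbits of column vectors and their stabilizers -/

section Orbits

open MulAction

/-- The number of functions with prescribed values outside the set where `P` holds. -/
theorem ncard_setOf_forall_not_eq {ι F : Type*} [Finite ι] [Finite F] (P : ι → Prop) (y : ι → F) :
    {x : ι → F | ∀ b, ¬ P b → x b = y b}.ncard = Nat.card F ^ {b | P b}.ncard := by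
  classical
  have := Fintype.ofFinite ι
  have := Fintype.ofFinite F
  have h : {x : ι → F | ∀ b, ¬ P b → x b = y b} =
      ↑(Fintype.piFinset fun b => if P b then Finset.univ else {y b}) := by
    ext x
    simp only [Set.mem_ofPred_eq, Finset.mem_coe, Fintype.mem_piFinset]
    refine forall_congr' fun b => ?_
    split_ifs with hb <;> simp [hb]
  rw [h, Set.ncard_coe_finset, Fintype.card_piFinset]
  simp only [apply_ite Finset.card, Finset.card_univ, Finset.card_singleton]
  rw [Finset.prod_ite, Finset.prod_const, Finset.prod_const_one, mul_one,
    Set.ncard_eq_toFinset_card', Nat.card_eq_fintype_card]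
  congr 2
  ext; simp

variable {F : Type*} [Field F] {m s i : ℕ}

/-- The column vector with the single entry `c` at `j`. -/
def singleCol (c : F) (j : FreePos m s i) : DualRow F m s i := fun b => if b = j then c else 0

theorem smul_singleCol (B : patternSubgroup F m (s - 1) (i - 1)) (c : F) (j a : FreePos m s i) :
    (B • singleCol c j) a = B.1.val a.1 j.1 * c := by
  rw [dualRow_smul_apply, Finset.sum_eq_single j]
  · simp [singleCol]
  · intro b _ hb
    simp [singleCol, hb]
  · simp

theorem le_val_freePos (hi : i ≤ 1) (b : FreePos m 0 i) : i ≤ b.1.val := by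
  have := b.2
  omega

/-- If at most the first position is not free, the orbit of a vector with a single entry consists
of all vectors with this entry in last position. -/
theorem mem_orbit_singleCol_iff (hi : i ≤ 1) {c : F} (hc : c ≠ 0) (j : FreePos m 0 i)
    (x : DualRow F m 0 i) :
    x ∈ orbit (patternSubgroup F m (0 - 1) (i - 1)) (singleCol c j) ↔
      x j = c ∧ ∀ b, j.1 < b.1 → x b = 0 := by
  constructor
  · rintro ⟨B, rfl⟩
    simp only [smul_singleCol]
    refine ⟨by rw [B.2.1.2, one_mul], fun b hb => by rw [B.2.1.1 _ _ hb, zero_mul]⟩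
  · rintro ⟨hj, hx⟩
    -- The matrix with column `j` proportional to `x` and the other columns as in the identity.
    let M : Matrix (Fin m) (Fin m) F := fun a b =>
      if a = b then 1 else if b = j.1 ∧ a < b then extendFree (s := 0) (i := i) x a / c else 0
    have h0 : ∀ a b : Fin m, b < a → M a b = 0 := fun a b h => by
      simp [M, h.ne', h.not_gt]
    have h1 : ∀ a, M a a = 1 := fun a => by simp [M]
    refine ⟨⟨unitriangularGL M h0 h1, ?_⟩, funext fun a => ?_⟩
    · rw [patternSubgroup_eq_unitriangular (Or.inl (by omega))]
      exact unitriangularGL_mem M h0 h1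
    · change (_ • singleCol c j : DualRow F m 0 i) a = x a
      rw [smul_singleCol, unitriangularGL_val]
      rcases lt_trichotomy a.1 j.1 with h | h | h
      · simp only [M, h.ne, h, if_false, and_self, if_true]
        rw [extendFree_coe x a, div_mul_cancel₀ _ hc]
      · rw [h, h1, one_mul, ← hj, Subtype.ext h]
      · rw [h0 _ _ h, zero_mul, hx a h]

theorem ncard_freePos_lt (hi : i ≤ 1) (j : FreePos m 0 i) :
    {b : FreePos m 0 i | b.1 < j.1}.ncard = j.1.val - i := by
  have hinj : Function.Injective fun b : FreePos m 0 i => b.1.val :=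
    Fin.val_injective.comp Subtype.val_injective
  rw [← Set.ncard_image_of_injective _ hinj]
  have : (fun b : FreePos m 0 i => b.1.val) '' {b | b.1 < j.1} = ↑(Finset.Ico i j.1.val) := by
    ext k
    simp only [Set.mem_image, Set.mem_ofPred_eq, Finset.coe_Ico, Set.mem_Ico]
    constructor
    · rintro ⟨b, hb, rfl⟩
      exact ⟨le_val_freePos hi b, hb⟩
    · rintro ⟨h1, h2⟩
      exact ⟨⟨⟨k, h2.trans j.1.2⟩, by simp only; omega⟩, h2, rfl⟩
  rw [this, Set.ncard_coe_finset, Nat.card_Ico]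

theorem ncard_orbit_singleCol [Finite F] (hi : i ≤ 1) {c : F} (hc : c ≠ 0) (j : FreePos m 0 i) :
    (orbit (patternSubgroup F m (0 - 1) (i - 1)) (singleCol c j)).ncard =
      Nat.card F ^ (j.1.val - i) := by
  rw [← ncard_freePos_lt hi, ← ncard_setOf_forall_not_eq _ (singleCol c j)]
  congr 1
  ext x
  rw [mem_orbit_singleCol_iff hi hc]
  simp only [not_lt]
  constructor
  · rintro ⟨h1, h2⟩ b hb
    rcases hb.eq_or_lt with hb | hb
    · rw [← Subtype.ext hb, h1]; simp [singleCol]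
    · rw [h2 b hb, singleCol, if_neg]
      rintro rfl
      exact lt_irrefl _ hb
  · intro h
    refine ⟨by simpa [singleCol] using h j le_rfl, fun b hb => ?_⟩
    rw [h b hb.le, singleCol, if_neg]
    rintro rfl
    exact lt_irrefl _ hb

/-- A matrix fixes a vector with a single entry at `j` when the free part of its column `j` vanishes
above the diagonal. -/
theorem numIrr_stabilizer_singleCol (hi : i ≤ 1) {c : F} (hc : c ≠ 0) (j : FreePos m 0 i) (k : ℕ) :
    numIrr k (stabilizer (patternSubgroup F m (0 - 1) (i - 1)) (singleCol c j)) =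
      numIrr k (patternSubgroup F m i j.1.val) := by
  have h : (stabilizer (patternSubgroup F m (0 - 1) (i - 1)) (singleCol c j)).map
      (Subgroup.subtype _) = patternSubgroup F m i j.1.val := by
    ext A
    rw [Subgroup.mem_map]
    constructor
    · rintro ⟨B, hB, rfl⟩
      refine ⟨B.2.1, fun a b hb ha hab => ?_⟩
      have h1 := congrFun (show B • singleCol c j = singleCol c j from hB)
        ⟨a, by omega⟩
      rw [smul_singleCol, singleCol, if_neg, mul_eq_zero, or_iff_left hc] at h1
      · rwa [Fin.ext hb]
      · intro h
        rw [← h] at hb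
        exact hab.ne (Fin.ext hb.symm)
    · intro hA
      have hA' : A ∈ patternSubgroup F m (0 - 1) (i - 1) := by
        rw [patternSubgroup_eq_unitriangular (Or.inl (by omega))]
        exact hA.1
      refine ⟨⟨A, hA'⟩, ?_, rfl⟩
      refine funext fun a => ?_
      rw [smul_singleCol, singleCol]
      split_ifs with h
      · rw [h, hA.1.2, one_mul]
      · rw [mul_eq_zero]
        left
        rcases lt_trichotomy a.1 j.1 with h1 | h1 | h1
        · exact hA.2 a.1 j.1 rfl (le_val_freePos hi a) h1
        · exact absurd (Subtype.ext h1) h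
        · exact hA.1.1 _ _ h1
  rw [numIrr_congr (Subgroup.equivMapOfInjective _ _ (Subgroup.subtype_injective _)), h]

end Orbits

/-! ### Recursions for the character numbers -/

section Recursion

open MulAction

variable {F : Type*} [Field F] {m s i : ℕ}

/-- The zero vector and the vectors with a single entry, which represent the orbits of column
vectors. -/
def orbitRep (F : Type*) [Field F] (m i : ℕ) : Option (Fˣ × FreePos m 0 i) → DualRow F m 0 i
  | none => fun _ => 0
  | some (c, j) => singleCol (c : F) j

theorem smul_orbitRep_none (B : patternSubgroup F m (0 - 1) (i - 1)) :
    B • orbitRep F m i none = orbitRep F m i none :=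
  funext fun a => by
    rw [dualRow_smul_apply]
    exact Finset.sum_eq_zero fun b _ => mul_zero _

theorem mem_orbit_orbitRep_none {x : DualRow F m 0 i} :
    x ∈ orbit (patternSubgroup F m (0 - 1) (i - 1)) (orbitRep F m i none) ↔ ∀ b, x b = 0 := by
  constructor
  · rintro ⟨B, rfl⟩ b
    exact congrFun (smul_orbitRep_none B) b
  · intro h
    exact ⟨1, (one_smul _ _).trans (funext fun b => (h b).symm)⟩

theorem orbitRep_injective (hi : i ≤ 1) (u v : Option (Fˣ × FreePos m 0 i))
    (h : orbitRep F m i u ∈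
      orbit (patternSubgroup F m (0 - 1) (i - 1)) (orbitRep F m i v)) : u = v := by
  match u, v with
  | none, none => rfl
  | none, some (c, j) =>
    have := ((mem_orbit_singleCol_iff hi c.ne_zero j _).1 h).1
    exact absurd this.symm c.ne_zero
  | some (c, j), none =>
    have := mem_orbit_orbitRep_none.1 h j
    simp [orbitRep, singleCol] at this
  | some (c, j), some (d, k) =>
    obtain ⟨h1, h2⟩ := (mem_orbit_singleCol_iff hi d.ne_zero k _).1 h
    simp only [orbitRep, singleCol] at h1 h2
    split_ifs at h1 with hkj
    · rw [hkj, Units.ext h1]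
    · exact absurd h1.symm d.ne_zero

theorem exists_mem_orbit_orbitRep (hi : i ≤ 1) (x : DualRow F m 0 i) :
    ∃ u, x ∈ orbit (patternSubgroup F m (0 - 1) (i - 1)) (orbitRep F m i u) := by
  classical
  by_cases hx : ∀ b, x b = 0
  · exact ⟨none, mem_orbit_orbitRep_none.2 hx⟩
  push Not at hx
  obtain ⟨b, hb⟩ := hx
  -- The representative is given by the last nonzero entry.
  obtain ⟨j, hj, hmax⟩ := Finset.exists_max_image
    (Finset.univ.filter fun b => x b ≠ 0) (fun b => b.1) ⟨b, by simpa using hb⟩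
  have hj' : x j ≠ 0 := by simpa using hj
  refine ⟨some (Units.mk0 (x j) hj', j),
    (mem_orbit_singleCol_iff hi hj' j x).2 ⟨rfl, fun b hjb => ?_⟩⟩
  by_contra hb0
  exact absurd hjb (not_lt.2 (hmax b (by simpa using hb0)))

/-- The count of characters of `U_{m+1}` (for `i = 0`) and of its subgroup of the matrices with
entry `0` next to the upper left corner (for `i = 1`) in terms of groups of size `m`. The summand
with index `l` comes from the orbits of the column vectors with last nonzero entry at `i + l`, which
have size `q ^ l`. -/
theorem numIrr_patternSubgroup_succ [Finite F] (hi : i ≤ 1) (e : ℕ) :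
    numIrr (Nat.card F ^ e) (patternSubgroup F (m + 1) 0 i) =
      numIrr (Nat.card F ^ e) (unitriangular F m) + (Nat.card F - 1) *
        ∑ l ∈ Finset.range (m - i), if l ≤ e then
          numIrr (Nat.card F ^ (e - l)) (patternSubgroup F m i (i + l)) else 0 := by
  classical
  have := Fintype.ofFinite F
  obtain ⟨ψ, hψ⟩ := exists_addChar_ne_one F
  have hq : 1 < Nat.card F := Finite.one_lt_card
  have hU : patternSubgroup F m (0 - 1) (i - 1) = unitriangular F m :=
    patternSubgroup_eq_unitriangular (Or.inl (by omega))
  rw [(rowExtension (s := 0) (i := i) (m := m) ψ hψ).numIrr_eq_sum (orbitRep F m i) _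
    (orbitRep_injective hi) (fun x _ => exists_mem_orbit_orbitRep hi x), Fintype.sum_option]
  congr 1
  · have h1 : orbit (patternSubgroup F m (0 - 1) (i - 1)) (orbitRep F m i none) =
        {orbitRep F m i none} := by
      refine Set.eq_singleton_iff_unique_mem.2 ⟨mem_orbit_self _, ?_⟩
      rintro _ ⟨B, rfl⟩
      exact smul_orbitRep_none B
    have h2 : stabilizer (patternSubgroup F m (0 - 1) (i - 1)) (orbitRep F m i none) = ⊤ :=
      eq_top_iff.2 fun B _ => smul_orbitRep_none B
    rw [h1, Set.ncard_singleton, if_pos (one_dvd _), Nat.div_one, h2,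
      numIrr_congr Subgroup.topEquiv, hU]
  · have h : ∀ (c : Fˣ) (j : FreePos m 0 i), (if (orbit (patternSubgroup F m (0 - 1) (i - 1))
          (orbitRep F m i (some (c, j)))).ncard ∣ Nat.card F ^ e then
        numIrr (Nat.card F ^ e / (orbit (patternSubgroup F m (0 - 1) (i - 1))
            (orbitRep F m i (some (c, j)))).ncard)
          (stabilizer (patternSubgroup F m (0 - 1) (i - 1)) (orbitRep F m i (some (c, j))))
        else 0) =
        if j.1.val - i ≤ e then
          numIrr (Nat.card F ^ (e - (j.1.val - i))) (patternSubgroup F m i (i + (j.1.val - i)))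
        else 0 := fun c j => by
      have ho := ncard_orbit_singleCol hi c.ne_zero j
      rw [orbitRep, ho]
      refine if_ctx_congr (Nat.pow_dvd_pow_iff_le_right hq) (fun hle => ?_) fun _ => rfl
      rw [numIrr_stabilizer_singleCol hi c.ne_zero, Nat.pow_div hle (by omega),
        Nat.add_sub_cancel' (le_val_freePos hi j)]
    rw [Fintype.sum_prod_type]
    simp only [h]
    rw [Finset.sum_const, Finset.card_univ, smul_eq_mul, Fintype.card_units,
      ← Nat.card_eq_fintype_card]
    congr 1
    refine Finset.sum_bij (fun j _ => j.1.val - i) ?_ ?_ ?_ ?_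
    · intro j _
      have := j.1.2
      have := le_val_freePos hi j
      rw [Finset.mem_range]
      omega
    · intro j _ k _ hjk
      have := le_val_freePos hi j
      have := le_val_freePos hi k
      exact Subtype.ext (Fin.ext (by omega))
    · intro l hl
      rw [Finset.mem_range] at hl
      exact ⟨⟨⟨i + l, by omega⟩, by simp only; omega⟩, Finset.mem_univ _, by simp⟩
    · intro j _
      rfl

/-- The fixed column vectors for the two patterns with `i = 2`: only the free ones among the first
two entries may be nonzero. -/
theorem mem_fixedPoints_dualRow_iff (hs : s ≤ 1) (x : DualRow F m s 2) :
    x ∈ fixedPoints (patternSubgroup F m (s - 1) (2 - 1)) (DualRow F m s 2) ↔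
      ∀ b : FreePos m s 2, ¬ b.1.val < 2 → x b = 0 := by
  constructor
  · intro hx b hb
    have hb0 := b.1.2
    let z : FreePos m s 2 := ⟨⟨0, by omega⟩, by simp⟩
    have hzb : z.1 ≠ b.1 := fun h => hb (by rw [← h]; simp [z])
    -- The elementary matrix with an additional entry `1` in the first row and column `b`.
    let M : Matrix (Fin m) (Fin m) F := fun a c =>
      if a = c then 1 else if a = z.1 ∧ c = b.1 then 1 else 0
    have h0 : ∀ a c : Fin m, c < a → M a c = 0 := fun a c h => by
      have : a ≠ z.1 := fun ha => by rw [ha, Fin.lt_def] at h; exact absurd h (Nat.not_lt_zero _)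
      simp [M, h.ne', this]
    have h1 : ∀ a, M a a = 1 := fun a => by simp [M]
    have hM : unitriangularGL M h0 h1 ∈ patternSubgroup F m (s - 1) (2 - 1) := by
      refine ⟨unitriangularGL_mem M h0 h1, fun a c hc _ hac => ?_⟩
      have : c ≠ b.1 := fun h => by rw [← h] at hb; omega
      rw [unitriangularGL_val]
      simp [M, hac.ne, this]
    have h := congrFun (hx ⟨_, hM⟩) z
    have hzb' : z ≠ b := fun h => hzb (congrArg Subtype.val h)
    rw [dualRow_smul_apply] at h
    simp only [unitriangularGL_val] at h
    rw [Finset.sum_eq_add z b hzb'] at h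
    · simpa [M, hzb] using h
    · intro c _ hc
      have h2 : z.1 ≠ c.1 := fun h => hc.1 (Subtype.ext h.symm)
      have h3 : c.1 ≠ b.1 := fun h => hc.2 (Subtype.ext h)
      simp [M, h2, h3]
    · simp
    · simp
  · intro hx B
    refine funext fun a => ?_
    rw [dualRow_smul_apply, Finset.sum_eq_single a, B.2.1.2, one_mul]
    · intro c _ hca
      by_cases hc : c.1.val < 2
      · rcases lt_trichotomy a.1 c.1 with h | h | h
        · rw [B.2.2 a c ?_ ?_ h, zero_mul]
          · rw [Fin.lt_def] at h; omega
          · omega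
        · exact absurd (Subtype.ext h.symm) hca
        · rw [B.2.1.1 _ _ h, zero_mul]
      · rw [hx c hc, mul_zero]
    · simp

theorem numIrr_one_patternSubgroup_two [Finite F] (hs : s ≤ 1) (hm : 2 ≤ m) :
    numIrr 1 (patternSubgroup F (m + 1) s 2) =
      Nat.card F ^ (s + 1) * numIrr 1 (patternSubgroup F m 0 1) := by
  classical
  have := Fintype.ofFinite F
  obtain ⟨ψ, hψ⟩ := exists_addChar_ne_one F
  have hs0 : s - 1 = 0 := by omega
  rw [(rowExtension (s := s) (i := 2) (m := m) ψ hψ).numIrr_one_eq_mul]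
  congr 1
  · have h : fixedPoints (patternSubgroup F m (s - 1) (2 - 1)) (DualRow F m s 2) =
        {x : FreePos m s 2 → F | ∀ b, ¬ b.1.val < 2 → x b = (0 : FreePos m s 2 → F) b} := by
      ext x
      exact mem_fixedPoints_dualRow_iff hs x
    rw [h]
    refine (ncard_setOf_forall_not_eq (fun b : FreePos m s 2 => b.1.val < 2) _).trans ?_
    congr 1
    have hinj : Function.Injective fun b : FreePos m s 2 => b.1.val :=
      Fin.val_injective.comp Subtype.val_injective
    rw [← Set.ncard_image_of_injective _ hinj]
    have : (fun b : FreePos m s 2 => b.1.val) '' {b | b.1.val < 2} =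
        ↑(Finset.range (s + 1)) := by
      ext k
      simp only [Set.mem_image, Set.mem_ofPred_eq, Finset.mem_coe, Finset.mem_range]
      constructor
      · rintro ⟨b, hb, rfl⟩
        have := b.2
        omega
      · intro hk
        exact ⟨⟨⟨k, by omega⟩, by simp only; omega⟩, by simp only; omega, rfl⟩
    rw [this, Set.ncard_coe_finset, Finset.card_range]
  · rw [hs0]

end Recursion

/-! ### Solving the recursions -/

section Solution

/-- The number of irreducible characters of degree `k` of `patternSubgroup F n s i`. -/
noncomputable def numIrrPattern (F : Type*) [Field F] (n s i k : ℕ) : ℕ :=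
  numIrr k (patternSubgroup F n s i)

theorem numIrrPattern_self (F : Type*) [Field F] (n s k : ℕ) :
    numIrrPattern F n s s k = numIrr k (unitriangular F n) := by
  rw [numIrrPattern, patternSubgroup_eq_unitriangular (Or.inl le_rfl)]

theorem numIrr_subgroupQ_one_three (F : Type*) [Field F] (n k : ℕ) :
    numIrr k (subgroupQ F n 1 3) = numIrrPattern F n 1 2 k := by
  rw [numIrrPattern, subgroupQ_one_three_eq]

variable {F : Type*} [Field F]

theorem numIrr_unitriangular_one (k : ℕ) :
    numIrr k (unitriangular F 1) = if k = 1 then 1 else 0 := by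
  have : Subsingleton (unitriangular F 1) := by
    refine ⟨fun A B => Subtype.ext (Units.ext ?_)⟩
    ext a b
    rw [Subsingleton.elim b a, A.2.2, B.2.2]
  exact numIrr_of_subsingleton _ k

variable [Finite F] {m i : ℕ}

/-- The recursion of `numIrr_patternSubgroup_succ` with the vanishing summands left out. -/
theorem numIrr_patternSubgroup_succ_int (hi : i ≤ 1) (e r : ℕ) (hr : min (m - i) (e + 1) = r) :
    (numIrrPattern F (m + 1) 0 i (Nat.card F ^ e) : ℤ) =
      numIrr (Nat.card F ^ e) (unitriangular F m) + ((Nat.card F : ℤ) - 1) *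
        ∑ l ∈ Finset.range r, numIrrPattern F m i (i + l) (Nat.card F ^ (e - l)) := by
  have h : (Finset.range (m - i)).filter (· ≤ e) = Finset.range r := by
    ext l
    simp only [Finset.mem_filter, Finset.mem_range]
    omega
  rw [numIrrPattern, numIrr_patternSubgroup_succ hi, ← Finset.sum_filter, h]
  push_cast [Nat.cast_sub (Finite.one_lt_card (α := F)).le]
  rfl

theorem numIrr_one_unitriangular (m : ℕ) :
    (numIrr 1 (unitriangular F (m + 1)) : ℤ) = (Nat.card F : ℤ) ^ m := by
  induction m with
  | zero => simp [numIrr_unitriangular_one]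
  | succ m ih =>
    have h := numIrr_patternSubgroup_succ_int (F := F) (m := m + 1) (i := 0) zero_le_one 0 1
      (by omega)
    simp only [pow_zero, Finset.sum_range_one, Nat.sub_self, add_zero, numIrrPattern_self, ih] at h
    rw [h]
    ring

theorem numIrr_one_patternSubgroup_zero_one (m : ℕ) :
    (numIrrPattern F (m + 3) 0 1 1 : ℤ) = (Nat.card F : ℤ) ^ (m + 2) := by
  have h := numIrr_patternSubgroup_succ_int (F := F) (m := m + 2) (i := 1) le_rfl 0 1 (by omega)
  simp only [pow_zero, Finset.sum_range_one, Nat.sub_self, add_zero, numIrrPattern_self,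
    numIrr_one_unitriangular] at h
  rw [h]
  ring

theorem numIrr_one_patternSubgroup_two_zero_one :
    (numIrrPattern F 2 0 1 1 : ℤ) = 1 := by
  have h := numIrr_patternSubgroup_succ_int (F := F) (m := 1) (i := 1) le_rfl 0 0 (by omega)
  simpa [numIrr_unitriangular_one] using h

theorem numIrr_one_patternSubgroup_zero_two (m : ℕ) :
    (numIrrPattern F (m + 4) 0 2 1 : ℤ) = (Nat.card F : ℤ) ^ (m + 3) := by
  rw [numIrrPattern, numIrr_one_patternSubgroup_two zero_le_one (by omega), Nat.cast_mul,
    ← numIrrPattern, numIrr_one_patternSubgroup_zero_one]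
  push_cast
  ring

theorem numIrr_one_patternSubgroup_three_zero_two :
    (numIrrPattern F 3 0 2 1 : ℤ) = Nat.card F := by
  rw [numIrrPattern, numIrr_one_patternSubgroup_two zero_le_one le_rfl, Nat.cast_mul,
    ← numIrrPattern, numIrr_one_patternSubgroup_two_zero_one]
  push_cast
  ring

theorem numIrr_one_patternSubgroup_one_two (m : ℕ) :
    (numIrrPattern F (m + 4) 1 2 1 : ℤ) = (Nat.card F : ℤ) ^ (m + 4) := by
  rw [numIrrPattern, numIrr_one_patternSubgroup_two le_rfl (by omega), Nat.cast_mul,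
    ← numIrrPattern, numIrr_one_patternSubgroup_zero_one]
  push_cast
  ring

theorem numIrr_one_patternSubgroup_three_one_two :
    (numIrrPattern F 3 1 2 1 : ℤ) = (Nat.card F : ℤ) ^ 2 := by
  rw [numIrrPattern, numIrr_one_patternSubgroup_two le_rfl le_rfl, Nat.cast_mul,
    ← numIrrPattern, numIrr_one_patternSubgroup_two_zero_one]
  push_cast
  ring

theorem numIrr_pow_unitriangular_two {e : ℕ} (he : e ≠ 0) :
    (numIrr (Nat.card F ^ e) (unitriangular F 2) : ℤ) = 0 := by
  have h := numIrr_patternSubgroup_succ_int (F := F) (m := 1) (i := 0) zero_le_one e 1 (by omega)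
  simpa [numIrrPattern_self, numIrr_unitriangular_one, he,
    (Finite.one_lt_card (α := F)).ne'] using h

theorem numIrr_card_unitriangular_succ (m : ℕ) :
    (numIrr (Nat.card F) (unitriangular F (m + 3)) : ℤ) =
      Nat.card F * numIrr (Nat.card F) (unitriangular F (m + 2)) +
        ((Nat.card F : ℤ) - 1) * numIrrPattern F (m + 2) 0 1 1 := by
  have h := numIrr_patternSubgroup_succ_int (F := F) (m := m + 2) (i := 0) zero_le_one 1 2
    (by omega)
  push_cast [Finset.sum_range_succ, Finset.sum_range_zero, pow_one, zero_add, Nat.sub_zero,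
    Nat.sub_self, pow_zero, numIrrPattern_self] at h
  rw [h]
  ring

theorem numIrr_card_unitriangular (m : ℕ) :
    (numIrr (Nat.card F) (unitriangular F (m + 3)) : ℤ) =
      (Nat.card F : ℤ) ^ m * ((Nat.card F : ℤ) - 1) * (m * (Nat.card F : ℤ) + 1) := by
  induction m with
  | zero =>
    have h := numIrr_pow_unitriangular_two (F := F) one_ne_zero
    rw [pow_one] at h
    rw [numIrr_card_unitriangular_succ, h, numIrr_one_patternSubgroup_two_zero_one]
    push_cast
    ring
  | succ m ih =>
    rw [numIrr_card_unitriangular_succ, ih, numIrr_one_patternSubgroup_zero_one]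
    push_cast
    ring

theorem numIrr_card_patternSubgroup_two :
    (numIrrPattern F 2 0 1 (Nat.card F) : ℤ) = 0 := by
  have h := numIrr_patternSubgroup_succ_int (F := F) (m := 1) (i := 1) le_rfl 1 0 (by omega)
  simpa [numIrr_unitriangular_one, (Finite.one_lt_card (α := F)).ne'] using h

theorem numIrr_card_patternSubgroup_three :
    (numIrrPattern F 3 0 1 (Nat.card F) : ℤ) = 0 := by
  have h := numIrr_patternSubgroup_succ_int (F := F) (m := 2) (i := 1) le_rfl 1 1 (by omega)
  have h2 := numIrr_pow_unitriangular_two (F := F) one_ne_zero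
  simp only [Finset.sum_range_one, add_zero, numIrrPattern_self, Nat.sub_zero, h2] at h
  simpa using h

theorem numIrr_card_patternSubgroup_succ (m : ℕ) :
    (numIrrPattern F (m + 4) 0 1 (Nat.card F) : ℤ) =
      Nat.card F * numIrr (Nat.card F) (unitriangular F (m + 3)) +
        ((Nat.card F : ℤ) - 1) * numIrrPattern F (m + 3) 1 2 1 := by
  have h := numIrr_patternSubgroup_succ_int (F := F) (m := m + 3) (i := 1) le_rfl 1 2 (by omega)
  push_cast [Finset.sum_range_succ, Finset.sum_range_zero, pow_one, zero_add, Nat.sub_zero,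
    Nat.sub_self, pow_zero, add_zero, numIrrPattern_self, Nat.reduceAdd] at h
  rw [h]
  ring

theorem numIrr_card_sq_unitriangular_succ (m : ℕ) :
    (numIrr (Nat.card F ^ 2) (unitriangular F (m + 4)) : ℤ) =
      Nat.card F * numIrr (Nat.card F ^ 2) (unitriangular F (m + 3)) + ((Nat.card F : ℤ) - 1) *
        (numIrrPattern F (m + 3) 0 1 (Nat.card F) +
          numIrrPattern F (m + 3) 0 2 1) := by
  have h := numIrr_patternSubgroup_succ_int (F := F) (m := m + 3) (i := 0) zero_le_one 2 3
    (by omega)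
  push_cast [Finset.sum_range_succ, Finset.sum_range_zero, zero_add, Nat.sub_zero,
    Nat.sub_self, pow_zero, numIrrPattern_self, Nat.reduceSub, pow_one] at h
  rw [h]
  ring

theorem numIrr_card_sq_unitriangular_three :
    (numIrr (Nat.card F ^ 2) (unitriangular F 3) : ℤ) = 0 := by
  have h := numIrr_patternSubgroup_succ_int (F := F) (m := 2) (i := 0) zero_le_one 2 2 (by omega)
  push_cast [Finset.sum_range_succ, Finset.sum_range_zero, zero_add, Nat.sub_zero,
    numIrrPattern_self, Nat.reduceSub, pow_one, numIrr_card_patternSubgroup_two,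
    numIrr_pow_unitriangular_two two_ne_zero] at h
  rw [h]
  ring

theorem numIrr_card_sq_unitriangular_four :
    (numIrr (Nat.card F ^ 2) (unitriangular F 4) : ℤ) =
      Nat.card F * ((Nat.card F : ℤ) - 1) := by
  rw [numIrr_card_sq_unitriangular_succ, numIrr_card_sq_unitriangular_three,
    numIrr_card_patternSubgroup_three, numIrr_one_patternSubgroup_three_zero_two]
  ring

/-- The recursion for the number of characters of degree `q ^ 2`, in terms of `N_1` of the group
`Q_{n,1,3}`. -/
theorem numIrr_card_sq_unitriangular_succ' (m : ℕ) :
    (numIrr (Nat.card F ^ 2) (unitriangular F (m + 5)) : ℤ) =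
      Nat.card F * numIrr (Nat.card F ^ 2) (unitriangular F (m + 4)) + ((Nat.card F : ℤ) - 1) *
        (Nat.card F * numIrr (Nat.card F) (unitriangular F (m + 3)) +
          ((Nat.card F : ℤ) - 1) * numIrr 1 (subgroupQ F (m + 3) 1 3) +
          (Nat.card F : ℤ) ^ (m + 3)) := by
  rw [numIrr_card_sq_unitriangular_succ, numIrr_card_patternSubgroup_succ,
    numIrr_subgroupQ_one_three,
    numIrr_one_patternSubgroup_zero_two]

theorem numIrr_card_sq_unitriangular_add_six (m : ℕ) :
    (numIrr (Nat.card F ^ 2) (unitriangular F (m + 6)) : ℤ) =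
      Nat.card F * numIrr (Nat.card F ^ 2) (unitriangular F (m + 5)) +
        (Nat.card F : ℤ) ^ (m + 2) * ((Nat.card F : ℤ) - 1) *
          ((Nat.card F : ℤ) ^ 3 + (m + 1) * (Nat.card F : ℤ) ^ 2 - m * Nat.card F - 1) := by
  rw [numIrr_card_sq_unitriangular_succ', numIrr_card_unitriangular, numIrr_subgroupQ_one_three,
    numIrr_one_patternSubgroup_one_two]
  push_cast
  ring

theorem numIrr_card_sq_unitriangular_five :
    (numIrr (Nat.card F ^ 2) (unitriangular F 5) : ℤ) =
      Nat.card F * ((Nat.card F : ℤ) - 1) * (2 * (Nat.card F : ℤ) ^ 2 + Nat.card F - 1) := by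
  rw [numIrr_card_sq_unitriangular_succ', numIrr_card_sq_unitriangular_four,
    numIrr_card_unitriangular, numIrr_subgroupQ_one_three, numIrr_one_patternSubgroup_three_one_two]
  push_cast
  ring

theorem numIrr_card_sq_unitriangular (m : ℕ) :
    (numIrr (Nat.card F ^ 2) (unitriangular F (m + 5)) : ℚ) =
      (Nat.card F : ℚ) ^ (m + 1) * ((Nat.card F : ℚ) - 1) *
        (m * (Nat.card F : ℚ) ^ 3 + ((m : ℚ) * (m + 1) / 2 + 2) * (Nat.card F : ℚ) ^ 2 +
          (1 - ((m : ℚ) - 1) * m / 2) * Nat.card F - (m + 1)) := by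
  induction m with
  | zero =>
    have h := congrArg (Int.cast : ℤ → ℚ) (numIrr_card_sq_unitriangular_five (F := F))
    push_cast at h
    rw [h]
    push_cast
    ring
  | succ m ih =>
    have h := congrArg (Int.cast : ℤ → ℚ) (numIrr_card_sq_unitriangular_add_six (F := F) m)
    push_cast at h
    rw [h, ih]
    push_cast
    ring

end Solution

theorem mainTheorem4 (F : Type*) [Field F] [Finite F] (q : ℕ) (hq : Nat.card F = q) (n : ℕ) :
    (6 ≤ n →
      (numIrr (q ^ 2) (unitriangular F n) : ℤ) =
          q * numIrr (q ^ 2) (unitriangular F (n - 1)) + q * numIrr q (unitriangular F (n - 1))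
            - q * numIrr q (unitriangular F (n - 2))
            + ((q : ℤ) - 1) ^ 2 * numIrr 1 (subgroupQ F (n - 2) 1 3) ∧
      (numIrr (q ^ 2) (unitriangular F n) : ℤ) =
          q * numIrr (q ^ 2) (unitriangular F (n - 1))
            + (q : ℤ) ^ (n - 4) * ((q : ℤ) - 1) *
              ((q : ℤ) ^ 3 + ((n : ℤ) - 5) * (q : ℤ) ^ 2 - ((n : ℤ) - 6) * q - 1)) ∧
    (5 ≤ n →
      (numIrr (q ^ 2) (unitriangular F n) : ℚ) =
          (q : ℚ) ^ (n - 4) * ((q : ℚ) - 1) *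
            (((n : ℚ) - 5) * (q : ℚ) ^ 3 + (((n : ℚ) - 5) * ((n : ℚ) - 4) / 2 + 2) * (q : ℚ) ^ 2
              + (1 - ((n : ℚ) - 6) * ((n : ℚ) - 5) / 2) * q - n + 4) ∧
      ∃ P : ℤ[X], ∀ x : ℚ, aeval x P =
          x ^ (n - 4) * (x - 1) *
            (((n : ℚ) - 5) * x ^ 3 + (((n : ℚ) - 5) * ((n : ℚ) - 4) / 2 + 2) * x ^ 2
              + (1 - ((n : ℚ) - 6) * ((n : ℚ) - 5) / 2) * x - n + 4)) ∧
    (3 ≤ n →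
      (numIrr q (unitriangular F n) : ℤ) =
          (q : ℤ) ^ (n - 3) * ((q : ℤ) - 1) * (((n : ℤ) - 3) * q + 1)) := by
  subst hq
  refine ⟨fun hn => ?_, fun hn => ?_, fun hn => ?_⟩
  · obtain ⟨t, rfl⟩ := Nat.exists_eq_add_of_le' hn
    rw [show t + 6 - 1 = t + 5 by omega, show t + 6 - 2 = t + 4 by omega,
      show t + 6 - 4 = t + 2 by omega]
    constructor
    · rw [numIrr_card_sq_unitriangular_succ' (t + 1), numIrr_card_unitriangular_succ (t + 2),
        numIrr_one_patternSubgroup_zero_one]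
      ring
    · rw [numIrr_card_sq_unitriangular_add_six]
      push_cast
      ring
  · obtain ⟨t, rfl⟩ := Nat.exists_eq_add_of_le' hn
    rw [show t + 5 - 4 = t + 1 by omega]
    constructor
    · rw [numIrr_card_sq_unitriangular]
      push_cast
      ring
    · -- The half-integral coefficients are binomial coefficients.
      refine ⟨X ^ (t + 1) * (X - 1) * (C (t : ℤ) * X ^ 3 + C (((t + 1).choose 2 : ℤ) + 2) * X ^ 2 +
        C (1 - (t.choose 2 : ℤ)) * X - C ((t : ℤ) + 1)), fun x => ?_⟩
      simp only [map_mul, map_add, map_sub, map_pow, aeval_X, map_one, map_natCast, map_ofNat,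
        Nat.cast_choose_two]
      push_cast
      ring
  · obtain ⟨t, rfl⟩ := Nat.exists_eq_add_of_le' hn
    rw [numIrr_card_unitriangular, show t + 3 - 3 = t by omega]
    push_cast
    ring
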